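/- Let $K$ be a field, $n\in\{1,2,3,4,5,7,9,11\}$, $R=K[x_1,\dots,x_n]$ with the $\mathbb Z^n$-grading in which $\deg x_i=e_i$ is the $i$-th canonical basis vector, and let $m=(x_1,\dots,x_n)$. A Stanley decomposition of a $\mathbb Z^n$-graded $R$-module $M$ is a finite family $\mathcal D=(R_i,u_i)_{i\in I}$ in which each $u_i\in M$ is homogeneous, each $R_i\subseteq R$ is a $\mathbb Z^n$-graded $K$-algebra retract of $R$ with $R_i\cap\operatorname{Ann}(u_i)=0$, and $M=\bigoplus_{i\in I}R_iu_i$ as a graded $K$-vector space. Its Stanley depth is the depth (with respect to $m$) of the $R$-module $\bigoplus_{i\in I}R_iu_i$, where $R_iu_i\cong R_i$ is an $R$-module through the retraction $R\to R_i$. The Stanley depth $\operatorname{sdepth}_n(M)$ of $M\neq 0$ is the maximum of the Stanley depths of its Stanley decompositions, and $\operatorname{sdepth}_n(0)=\infty$. Then, for the natural $\mathbb Z^n$-gradings on $m$ and $R\oplus m$, the maxima defining $\operatorname{sdepth}_n(m)$ and $\operatorname{sdepth}_n(R\oplus m)$ exist and $$\operatorname{sdepth}_n(m)=\operatorname{sdepth}_n(R\oplus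 m).$$ -/

import Mathlib

open MvPolynomial

namespace StanleyDepth

universe u v

/-- The depth of an `S`-module `N` with respect to an ideal `J`: the supremum of the lengths of the
`N`-regular sequences contained in `J`. -/
noncomputable def moduleDepth {S : Type u} [CommRing S] (J : Ideal S)
    (N : Type v) [AddCommGroup N] [Module S N] : ℕ∞ :=
  sSup {d : ℕ∞ | ∃ rs : List S, (∀ r ∈ rs, r ∈ J) ∧ RingTheory.Sequence.IsRegular N rs ∧
    d = (rs.length : ℕ∞)}

/-- The `a`-th homogeneous component, `a ∈ ℤⁿ`, of `R = K[x₁, …, xₙ]` for the multigrading in which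
`xᵢ` has degree the `i`-th canonical basis vector. -/
noncomputable def multigrading (K : Type u) [Field K] (n : ℕ) (a : Fin n → ℤ) :
    Submodule K (MvPolynomial (Fin n) K) :=
  weightedHomogeneousSubmodule K (fun i : Fin n => (Pi.single i 1 : Fin n → ℤ)) a

/-- A `ℤⁿ`-graded `K`-algebra retract of `R = K[x₁, …, xₙ]`. It is given by the composite
`R → A → R` of the graded retraction with the graded inclusion, i.e. by an idempotent graded
`K`-algebra endomorphism of `R`; the retract itself is its range. -/
structure GradedRetract (K : Type u) [Field K] (n : ℕ) where
  proj : MvPolynomial (Fin n) K →ₐ[K] MvPolynomial (Fin n) K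
  proj_proj : ∀ f, proj (proj f) = proj f
  proj_mem : ∀ (a : Fin n → ℤ), ∀ f ∈ multigrading K n a, proj f ∈ multigrading K n a

namespace GradedRetract

variable {K : Type u} [Field K] {n : ℕ}

/-- The retract as a `K`-subalgebra of `R`. -/
noncomputable def subalgebra (A : GradedRetract K n) : Subalgebra K (MvPolynomial (Fin n) K) :=
  A.proj.range

/-- The retract `A` regarded as an `R`-module through the retraction `R → A`, that is with the
action `r • s = proj r * s` (in general not the multiplication of `R`, for which `A` need not be
stable). -/
def AsModule (A : GradedRetract K n) : Type u := A.proj.range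

noncomputable instance (A : GradedRetract K n) : AddCommGroup A.AsModule :=
  inferInstanceAs (AddCommGroup A.proj.range)

noncomputable instance (A : GradedRetract K n) : Module (MvPolynomial (Fin n) K) A.AsModule :=
  Module.compHom A.proj.range A.proj.rangeRestrict.toRingHom

end GradedRetract

section

variable {K : Type u} [Field K] {n : ℕ} {M : Type v} [AddCommGroup M]
  [Module (MvPolynomial (Fin n) K) M] [Module K M] [IsScalarTower K (MvPolynomial (Fin n) K) M]

/-- The `K`-subspace `A u = {r u | r ∈ A}` of `M`. -/
noncomputable def retractSpan (A : GradedRetract K n) (u : M) : Submodule K M :=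
  (Subalgebra.toSubmodule A.subalgebra).map
    ((LinearMap.toSpanSingleton (MvPolynomial (Fin n) K) M u).restrictScalars K)

/-- A Stanley decomposition of an `R`-module `M` with `ℤⁿ`-grading `𝓜`: a finite family
`(Rᵢ, uᵢ)` of `ℤⁿ`-graded retracts `Rᵢ` of `R` and homogeneous elements `uᵢ` of `M` with
`Rᵢ ∩ Ann(uᵢ) = 0` and `M = ⨁ Rᵢ uᵢ` as a (graded) `K`-vector space. -/
structure StanleyDecomposition (𝓜 : (Fin n → ℤ) → Submodule K M) where
  size : ℕ
  retract : Fin size → GradedRetract K n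
  gen : Fin size → M
  gen_homogeneous : ∀ i, ∃ a, gen i ∈ 𝓜 a
  ann_eq_zero : ∀ i, ∀ r ∈ (retract i).subalgebra, r • gen i = 0 → r = 0
  isInternal : DirectSum.IsInternal fun i => retractSpan (retract i) (gen i)

/-- The Stanley depth of a Stanley decomposition `(Rᵢ, uᵢ)`: the depth, with respect to the
maximal ideal `(x₁, …, xₙ)`, of the `R`-module `⨁ Rᵢ uᵢ`. Each `Rᵢ uᵢ` is isomorphic to `Rᵢ`
(as `Rᵢ ∩ Ann(uᵢ) = 0`) and is an `R`-module through the retraction `R → Rᵢ`. -/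
noncomputable def StanleyDecomposition.depth {𝓜 : (Fin n → ℤ) → Submodule K M}
    (D : StanleyDecomposition 𝓜) : ℕ∞ :=
  moduleDepth (idealOfVars (Fin n) K) (DirectSum (Fin D.size) fun i => (D.retract i).AsModule)

/-- The set of the Stanley depths of all Stanley decompositions of `M`. -/
def stanleyDepths (𝓜 : (Fin n → ℤ) → Submodule K M) : Set ℕ∞ :=
  Set.range fun D : StanleyDecomposition 𝓜 => D.depth

open Classical in
/-- The (`ℤⁿ`-graded) Stanley depth of `M`: the largest Stanley depth of a Stanley decomposition
of `M`, and `∞` if `M = 0`. -/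
noncomputable def sdepth (𝓜 : (Fin n → ℤ) → Submodule K M) : ℕ∞ :=
  if Subsingleton M then ⊤ else sSup (stanleyDepths 𝓜)

end

/-- The `ℤⁿ`-grading that the maximal ideal `m = (x₁, …, xₙ)` inherits from `R`. -/
noncomputable def maxIdealGrading (K : Type u) [Field K] (n : ℕ) (a : Fin n → ℤ) :
    Submodule K (idealOfVars (Fin n) K) :=
  (multigrading K n a).comap ((idealOfVars (Fin n) K).subtype.restrictScalars K)

/-- The `ℤⁿ`-grading of `R ⊕ m`. -/
noncomputable def directSumGrading (K : Type u) [Field K] (n : ℕ) (a : Fin n → ℤ) :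
    Submodule K (MvPolynomial (Fin n) K × idealOfVars (Fin n) K) :=
  (multigrading K n a).prod (maxIdealGrading K n a)

end StanleyDepth

/-! Both Stanley depths equal `(n + 1) / 2`, that is, n/2 rounded up.

A graded retract can only be a coordinate subring K[Z] = K[xᵢ : i ∈ Z]: by degree xᵢ goes to c xᵢ,
and idempotence forces c = 0 or c = 1 (`proj_eq`). The depth of a nonempty direct sum of such rings
is the least |Z|. It is no larger because a regular sequence in the ideal of variables cannot be
longer than dim K[Z] (`moduleDepth_le_card_vars`). It is no smaller because the elementary symmetric
polynomials e₁, …, e_c form a regular sequence on every K[Z] with c ≤ |Z|, over any field, finite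
ones included (`isRegularModulo_esymmList`).

Lower bound: a partition of the nonempty subsets of {1, …, n} into intervals [A, B] gives m = ⨁ x^A
K[B]. Explicit partitions with |B| ≥ (n+1)/2 come from `exists_interval_partition`; adding the free
summand R gives a decomposition of R ⊕ m of at least the same depth.

Upper bound: for R ⊕ m, the multigraded components have dimension 1 in degree 0 and 2 in every other
degree of ℕⁿ. Counting generators in degrees 0 and eⱼ, and their multiples in degrees eⱼ + eₖ,
yields a quadratic inequality (`exists_card_vars_bound`). It fails for the listed n if every retract
has more than (n+1)/2 variables. The bound for m follows by adding R to a decomposition of m. -/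

namespace StanleyDepth

universe u v

/-! ### Interval partitions of the nonempty subsets, verified on bit masks -/

/-- Rotation by `j` of the subset of `ℤ/n` encoded by the binary digits of `m`. -/
def rotate (n j m : ℕ) : ℕ := m * 2 ^ j % 2 ^ n + m * 2 ^ j / 2 ^ n

/-- The family of the first `k` rotations of each of the pairs in a list of triples `(A, B, k)`. -/
def rotations (n : ℕ) (l : List (ℕ × ℕ × ℕ)) : List (ℕ × ℕ) :=
  l.flatMap fun p => (List.range p.2.2).map fun j => (rotate n j p.1, rotate n j p.2.1)

/-- The pairs `(A, B)` in the list have `A` nonempty, `A ⊆ B`, `A < 2 ^ n` and `c ≤ |B|`. -/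
def boundsCheck (n c : ℕ) (l : List (ℕ × ℕ)) : Bool :=
  l.all fun p => (List.finRange n).any (fun i : Fin n => p.1.testBit i) &&
    Nat.beq (p.1 &&& p.2) p.1 && Nat.ble (p.1 + 1) (2 ^ n) &&
    Nat.ble c ((List.finRange n).countP fun i : Fin n => p.2.testBit i)

/-- The intervals `[A, B]` in the list are pairwise disjoint. -/
def disjointCheck : List (ℕ × ℕ) → Bool
  | [] => true
  | p :: l => (l.all fun q => !Nat.beq ((p.1 ||| q.1) &&& (p.2 &&& q.2)) (p.1 ||| q.1)) &&
      disjointCheck l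

/-- The intervals in the list cover all nonempty sets with less than `c` elements. -/
def coverCheck (n c : ℕ) (l : List (ℕ × ℕ)) : Bool :=
  (List.range (2 ^ n)).all fun m => Nat.beq m 0 ||
    Nat.ble c ((List.finRange n).countP fun i : Fin n => m.testBit i) ||
    (l.any fun p => Nat.beq (p.1 &&& m) p.1 && Nat.beq (m &&& p.2) m)

/-- The sets missed by these intervals are large and will be added as one-point intervals. The pair
(73, 365) for n = 9 is invariant under rotation by 3, hence only three rotations. For n = 1, 2 the
bound is 1, so no interval is needed. -/
def intervalTable : ℕ → List (ℕ × ℕ)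
  | 3 => rotations 3 [(1, 3, 3)]
  | 4 => rotations 4 [(1, 3, 4)]
  | 5 => rotations 5 [(1, 7, 5)]
  | 7 => rotations 7 [(1, 15, 7), (21, 23, 7), (19, 27, 7)]
  | 9 => rotations 9 [(1, 31, 9), (35, 295, 9), (41, 299, 9), (37, 301, 9), (51, 307, 9),
      (53, 309, 9), (85, 341, 9), (73, 365, 3)]
  | 11 => rotations 11 [(1, 63, 11), (205, 221, 11), (233, 237, 11), (217, 249, 11),
      (299, 303, 11), (301, 317, 11), (331, 335, 11), (333, 349, 11), (137, 669, 11),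
      (67, 1103, 11), (81, 1111, 11), (89, 1115, 11), (77, 1117, 11), (99, 1127, 11),
      (105, 1131, 11), (101, 1133, 11), (115, 1139, 11), (117, 1141, 11), (121, 1145, 11),
      (229, 1253, 11), (341, 1365, 11), (73, 1481, 11), (69, 1861, 11)]
  | _ => []

theorem intervalTable_checks {n : ℕ} (hn : n ∈ ({1, 2, 3, 4, 5, 7, 9, 11} : Finset ℕ)) :
    boundsCheck n ((n + 1) / 2) (intervalTable n) = true ∧
      disjointCheck (intervalTable n) = true ∧
      coverCheck n ((n + 1) / 2) (intervalTable n) = true := by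
  revert n
  decide +kernel

/-- The subset of `Fin n` encoded by the binary digits of `m`. -/
def bitSet (n m : ℕ) : Finset (Fin n) := Finset.univ.filter fun i => m.testBit i

@[simp]
theorem mem_bitSet {n m : ℕ} {i : Fin n} : i ∈ bitSet n m ↔ m.testBit i = true := by
  simp [bitSet]

theorem bitSet_subset_of_land {n a b : ℕ} (h : Nat.beq (a &&& b) a = true) :
    bitSet n a ⊆ bitSet n b := by
  intro i hi
  rw [mem_bitSet] at hi ⊢
  rw [← Nat.eq_of_beq_eq_true h, Nat.testBit_land, Bool.and_eq_true] at hi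
  exact hi.2

theorem card_bitSet (n m : ℕ) :
    (bitSet n m).card = (List.finRange n).countP fun i : Fin n => m.testBit i := by
  rw [List.countP_eq_length_filter, ← List.toFinset_card_of_nodup
    ((List.nodup_finRange n).filter _)]
  congr 1
  ext i
  simp

theorem exists_bitSet_eq {n : ℕ} (s : Finset (Fin n)) : ∃ m < 2 ^ n, bitSet n m = s := by
  have hinj : Function.Injective fun m : Fin (2 ^ n) => bitSet n m := by
    intro a b hab
    refine Fin.ext (Nat.eq_of_testBit_eq fun i => ?_)
    rcases lt_or_ge i n with hi | hi
    · have := Finset.ext_iff.1 hab ⟨i, hi⟩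
      rw [mem_bitSet, mem_bitSet] at this
      exact Bool.eq_iff_iff.2 this
    · have h2 : 2 ^ n ≤ 2 ^ i := Nat.pow_le_pow_right two_pos hi
      rw [Nat.testBit_lt_two_pow (a.2.trans_le h2), Nat.testBit_lt_two_pow (b.2.trans_le h2)]
  have hbij := (Fintype.bijective_iff_injective_and_card _).2 ⟨hinj, by simp⟩
  obtain ⟨m, hm⟩ := hbij.2 s
  exact ⟨m, m.2, hm⟩

/-- Intervals [A, B] and [A', B'] share a set exactly when A ∪ A' ⊆ B ∩ B'. The bounds by 2 ^ n are
there because `bitSet n` does not see the higher bits. -/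
theorem disjoint_of_disjointCheck {n : ℕ} {l : List (ℕ × ℕ)} (h : disjointCheck l = true) :
    l.Pairwise fun p q => ∀ s : ℕ, bitSet n p.1 ⊆ bitSet n s → bitSet n s ⊆ bitSet n p.2 →
      bitSet n q.1 ⊆ bitSet n s → bitSet n s ⊆ bitSet n q.2 → p.1 < 2 ^ n → q.1 < 2 ^ n → False := by
  induction l with
  | nil => exact List.Pairwise.nil
  | cons p l ih =>
    rw [disjointCheck, Bool.and_eq_true, List.all_eq_true] at h
    refine List.Pairwise.cons (fun q hq s h1 h2 h3 h4 hp hq' => ?_) (ih h.2)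
    have := h.1 q hq
    rw [Bool.not_eq_true', ← Bool.not_eq_true, Nat.beq_eq] at this
    refine this (Nat.eq_of_testBit_eq fun i => ?_)
    rcases lt_or_ge i n with hi | hi
    · have e1 := @h1 ⟨i, hi⟩
      have e2 := @h2 ⟨i, hi⟩
      have e3 := @h3 ⟨i, hi⟩
      have e4 := @h4 ⟨i, hi⟩
      simp only [mem_bitSet] at e1 e2 e3 e4
      simp only [Nat.testBit_land, Nat.testBit_lor]
      grind
    · have h2 : 2 ^ n ≤ 2 ^ i := Nat.pow_le_pow_right two_pos hi
      simp [Nat.testBit_lt_two_pow (hp.trans_le h2), Nat.testBit_lt_two_pow (hq'.trans_le h2)]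

theorem exists_interval_partition {n : ℕ} (hn : n ∈ ({1, 2, 3, 4, 5, 7, 9, 11} : Finset ℕ)) :
    ∃ (N : ℕ) (A B : Fin N → Finset (Fin n)), (∀ i, (A i).Nonempty) ∧ (∀ i, A i ⊆ B i) ∧
      (∀ i, (n + 1) / 2 ≤ (B i).card) ∧
      ∀ s : Finset (Fin n), s.Nonempty → ∃! i, A i ⊆ s ∧ s ⊆ B i := by
  classical
  obtain ⟨hb, hd, hc⟩ := intervalTable_checks hn
  set l := intervalTable n
  simp only [boundsCheck, List.all_eq_true, Bool.and_eq_true, List.any_eq_true] at hb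
  have hpair := disjoint_of_disjointCheck (n := n) hd
  -- Each uncovered set s becomes the interval [s, s]; `coverCheck` guarantees that s is large
  -- enough.
  let U := {s : Finset (Fin n) // s.Nonempty ∧ ∀ p ∈ l, ¬ (bitSet n p.1 ⊆ s ∧ s ⊆ bitSet n p.2)}
  let A : Fin l.length ⊕ U → Finset (Fin n) :=
    Sum.elim (fun i => bitSet n (l.get i).1) (fun s => s.1)
  let B : Fin l.length ⊕ U → Finset (Fin n) :=
    Sum.elim (fun i => bitSet n (l.get i).2) (fun s => s.1)
  have hA : ∀ i, (A i).Nonempty := by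
    rintro (i | s)
    · obtain ⟨⟨⟨⟨x, -, hx⟩, -⟩, -⟩, -⟩ := hb (l.get i) (List.get_mem _ _)
      exact ⟨x, mem_bitSet.2 hx⟩
    · exact s.2.1
  have hAB : ∀ i, A i ⊆ B i := by
    rintro (i | s)
    · exact bitSet_subset_of_land (hb (l.get i) (List.get_mem _ _)).1.1.2
    · exact subset_rfl
  have hB : ∀ i, (n + 1) / 2 ≤ (B i).card := by
    rintro (i | s)
    · have := (hb (l.get i) (List.get_mem _ _)).2
      rw [← card_bitSet] at this
      exact Nat.le_of_ble_eq_true this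
    · obtain ⟨m, hm, hms⟩ := exists_bitSet_eq s.1
      rw [coverCheck, List.all_eq_true] at hc
      have := hc m (List.mem_range.2 hm)
      rw [Bool.or_eq_true, Bool.or_eq_true, ← card_bitSet, hms, List.any_eq_true] at this
      rcases this with (h0 | h1) | ⟨p, hp, hp2⟩
      · exfalso
        rw [Nat.eq_of_beq_eq_true h0] at hms
        obtain ⟨x, hx⟩ := s.2.1
        simp [← hms] at hx
      · exact Nat.le_of_ble_eq_true h1
      · rw [Bool.and_eq_true] at hp2
        refine absurd ⟨?_, ?_⟩ (s.2.2 p hp)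
        · rw [← hms]; exact bitSet_subset_of_land hp2.1
        · rw [← hms]; exact bitSet_subset_of_land hp2.2
  have hlt : ∀ i j : Fin l.length, i < j → ∀ s : Finset (Fin n), bitSet n (l.get i).1 ⊆ s →
      s ⊆ bitSet n (l.get i).2 → bitSet n (l.get j).1 ⊆ s → s ⊆ bitSet n (l.get j).2 → False := by
    intro i j hij s
    obtain ⟨m, hm, rfl⟩ := exists_bitSet_eq s
    intro h1 h2 h3 h4
    exact List.pairwise_iff_get.1 hpair i j hij m h1 h2 h3 h4
      (Nat.le_of_ble_eq_true (hb _ (List.get_mem _ _)).1.2)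
      (Nat.le_of_ble_eq_true (hb _ (List.get_mem _ _)).1.2)
  have huniq : ∀ s : Finset (Fin n), s.Nonempty → ∃! i, A i ⊆ s ∧ s ⊆ B i := by
    intro s hs
    by_cases h : ∃ p ∈ l, bitSet n p.1 ⊆ s ∧ s ⊆ bitSet n p.2
    · obtain ⟨p, hp, hps⟩ := h
      obtain ⟨i, rfl⟩ := List.mem_iff_get.1 hp
      refine ⟨Sum.inl i, hps, ?_⟩
      rintro (j | u) hj
      · rcases lt_trichotomy i j with hij | rfl | hij
        · exact (hlt i j hij s hps.1 hps.2 hj.1 hj.2).elim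
        · rfl
        · exact (hlt j i hij s hj.1 hj.2 hps.1 hps.2).elim
      · have : u.1 = s := subset_antisymm hj.1 hj.2
        exact absurd hps (this ▸ u.2.2 _ hp)
    · push Not at h
      have hu : s.Nonempty ∧ ∀ p ∈ l, ¬ (bitSet n p.1 ⊆ s ∧ s ⊆ bitSet n p.2) :=
        ⟨hs, fun p hp hps => h p hp hps.1 hps.2⟩
      refine ⟨Sum.inr ⟨s, hu⟩, ⟨subset_rfl, subset_rfl⟩, ?_⟩
      rintro (j | u) hj
      · exact absurd hj.2 (h _ (List.get_mem _ _) hj.1)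
      · exact congrArg Sum.inr (Subtype.ext (subset_antisymm hj.1 hj.2))
  let e := Fintype.equivFin (Fin l.length ⊕ U)
  refine ⟨_, A ∘ e.symm, B ∘ e.symm, fun i => hA _, fun i => hAB _, fun i => hB _, fun s hs => ?_⟩
  obtain ⟨i, hi, hi'⟩ := huniq s hs
  exact ⟨e i, by simpa using hi, fun j hj => by rw [← hi' _ hj, Equiv.apply_symm_apply]⟩

/-! ### Graded retracts are coordinate subrings -/

section Retract

variable {K : Type u} [Field K] {n : ℕ}

theorem weight_single_eq (d : Fin n →₀ ℕ) :
    Finsupp.weight (fun i : Fin n => (Pi.single i 1 : Fin n → ℤ)) d = fun i => (d i : ℤ) := by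
  funext j
  rw [Finsupp.weight_apply, Finsupp.sum_fintype _ _ (by simp)]
  simp [Finset.sum_apply, Pi.single_apply]

theorem mem_multigrading {a : Fin n → ℤ} {f : MvPolynomial (Fin n) K} :
    f ∈ multigrading K n a ↔ ∀ d, coeff d f ≠ 0 → (fun i => (d i : ℤ)) = a := by
  rw [multigrading, mem_weightedHomogeneousSubmodule, IsWeightedHomogeneous]
  simp only [weight_single_eq]

theorem monomial_mem_multigrading (d : Fin n →₀ ℕ) (r : K) :
    monomial d r ∈ multigrading K n fun i => (d i : ℤ) := by
  classical
  rw [mem_multigrading]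
  intro e he
  rw [coeff_monomial] at he
  rw [(ite_ne_right_iff.1 he).1]

/-- An element of a multigraded component is a scalar multiple of a monomial. -/
theorem eq_monomial_of_mem_multigrading {d : Fin n →₀ ℕ} {f : MvPolynomial (Fin n) K}
    (hf : f ∈ multigrading K n fun i => (d i : ℤ)) : f = monomial d (coeff d f) := by
  classical
  ext e
  rw [coeff_monomial]
  split_ifs with h
  · rw [h]
  · by_contra he
    refine h (Finsupp.ext fun i => ?_)
    have := congrFun (mem_multigrading.1 hf e he) i
    exact_mod_cast this.symm

/-- The endomorphism of `K[x₁, …, xₙ]` that fixes the variables in `Z` and kills the others. -/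
noncomputable def coordProj (K : Type u) [Field K] {n : ℕ} (Z : Finset (Fin n)) :
    MvPolynomial (Fin n) K →ₐ[K] MvPolynomial (Fin n) K :=
  aeval fun i => if i ∈ Z then X i else 0

theorem coordProj_monomial (Z : Finset (Fin n)) (d : Fin n →₀ ℕ) (r : K) :
    coordProj K Z (monomial d r) = if d.support ⊆ Z then monomial d r else 0 := by
  rw [coordProj, aeval_monomial]
  split_ifs with h
  · rw [monomial_eq, algebraMap_eq]
    congr 1
    refine Finset.prod_congr rfl fun i hi => ?_
    simp only [if_pos (h hi)]
  · obtain ⟨i, hi, hiZ⟩ := Finset.not_subset.1 h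
    rw [Finsupp.prod, Finset.prod_eq_zero hi, mul_zero]
    rw [if_neg hiZ, zero_pow (Finsupp.mem_support_iff.1 hi)]

theorem coeff_coordProj (Z : Finset (Fin n)) (d : Fin n →₀ ℕ) (f : MvPolynomial (Fin n) K) :
    coeff d (coordProj K Z f) = if d.support ⊆ Z then coeff d f else 0 := by
  classical
  induction f using MvPolynomial.induction_on' with
  | monomial e r =>
    rw [coordProj_monomial, apply_ite (coeff d), coeff_monomial, coeff_zero]
    by_cases h : e = d
    · subst h; rfl
    · simp [h]
  | add p q hp hq =>
    rw [map_add, coeff_add, hp, hq, coeff_add]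
    split_ifs <;> simp

/-- The ideal generated by the variables not in `Z`. -/
noncomputable def coordIdeal (K : Type u) [Field K] {n : ℕ} (Z : Finset (Fin n)) :
    Ideal (MvPolynomial (Fin n) K) :=
  Ideal.span (X '' {i | i ∉ Z})

theorem mem_coordIdeal {Z : Finset (Fin n)} {f : MvPolynomial (Fin n) K} :
    f ∈ coordIdeal K Z ↔ ∀ d : Fin n →₀ ℕ, d.support ⊆ Z → coeff d f = 0 := by
  rw [coordIdeal, mem_ideal_span_X_image]
  refine forall_congr' fun d => ?_
  rw [mem_support_iff, ← not_imp_not, not_not]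
  refine imp_congr_left ?_
  simp only [Set.mem_ofPred_eq, ← Finsupp.mem_support_iff, Finset.subset_iff]
  push Not
  exact ⟨fun h i hi => by_contra fun hc => h i hc hi, fun h i hi hc => hi (h hc)⟩

theorem coordProj_eq_zero_iff {Z : Finset (Fin n)} {f : MvPolynomial (Fin n) K} :
    coordProj K Z f = 0 ↔ f ∈ coordIdeal K Z := by
  rw [mem_coordIdeal, MvPolynomial.ext_iff]
  refine forall_congr' fun d => ?_
  rw [coeff_coordProj, coeff_zero, ite_eq_right_iff]

theorem coordProj_coordProj (Z : Finset (Fin n)) (f : MvPolynomial (Fin n) K) :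
    coordProj K Z (coordProj K Z f) = coordProj K Z f := by
  ext d
  rw [coeff_coordProj, coeff_coordProj]
  split_ifs <;> rfl

theorem mem_range_coordProj {Z : Finset (Fin n)} {f : MvPolynomial (Fin n) K} :
    f ∈ (coordProj K Z).range ↔ ∀ d, coeff d f ≠ 0 → d.support ⊆ Z := by
  constructor
  · rintro ⟨g, rfl⟩ d hd
    erw [coeff_coordProj] at hd
    exact (ite_ne_right_iff.1 hd).1
  · intro h
    refine ⟨f, MvPolynomial.ext _ _ fun d => ?_⟩
    erw [coeff_coordProj]
    by_cases hd : coeff d f = 0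
    · simp [hd]
    · rw [if_pos (h d hd)]

namespace GradedRetract

/-- The retract `K[xᵢ : i ∈ Z]`. -/
noncomputable def ofVars (K : Type u) [Field K] {n : ℕ} (Z : Finset (Fin n)) :
    GradedRetract K n where
  proj := coordProj K Z
  proj_proj := coordProj_coordProj Z
  proj_mem a f hf := by
    rw [mem_multigrading] at hf ⊢
    intro d hd
    rw [coeff_coordProj] at hd
    exact hf d (ite_ne_right_iff.1 hd).2

open Classical in
/-- The variables contained in a retract. -/
noncomputable def vars (A : GradedRetract K n) : Finset (Fin n) :=
  Finset.univ.filter fun i => A.proj (X i) = X i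

theorem mem_vars {A : GradedRetract K n} {i : Fin n} : i ∈ A.vars ↔ A.proj (X i) = X i := by
  simp [vars]

theorem proj_eq (A : GradedRetract K n) : A.proj = coordProj K A.vars := by
  refine MvPolynomial.algHom_ext fun i => ?_
  rw [coordProj, aeval_X]
  split_ifs with h <;> rw [mem_vars] at h
  · exact h
  · have h1 := A.proj_mem _ _ (monomial_mem_multigrading (K := K) (Finsupp.single i 1) 1)
    have h2 : A.proj (X i) = C (coeff (Finsupp.single i 1) (A.proj (X i))) * X i := by
      conv_lhs => rw [show (X i : MvPolynomial (Fin n) K) = monomial (Finsupp.single i 1) 1 from rfl,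
        eq_monomial_of_mem_multigrading h1]
      rw [C_mul_X_eq_monomial]
      rfl
    set c := coeff (Finsupp.single i 1) (A.proj (X i))
    -- Idempotence gives c² = c, so c is 0 or 1.
    have h3 : C c * (C c * X i) = C c * (X i : MvPolynomial (Fin n) K) := by
      have := A.proj_proj (X i)
      rw [h2, map_mul, h2] at this
      simpa [← algebraMap_eq] using this
    by_cases hc : c = 0
    · rw [h2, hc, C_0, zero_mul]
    · have hC : (C c : MvPolynomial (Fin n) K) ≠ 0 := by simpa using hc
      exact absurd (h2.trans (mul_left_cancel₀ hC h3)) h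

theorem vars_ofVars (Z : Finset (Fin n)) : (ofVars K Z).vars = Z := by
  ext i
  rw [mem_vars]
  change coordProj K Z (X i) = X i ↔ _
  rw [coordProj, aeval_X]
  split_ifs with h
  · simp [h]
  · simp [h, (X_ne_zero i).symm]

theorem mem_subalgebra {A : GradedRetract K n} {f : MvPolynomial (Fin n) K} :
    f ∈ A.subalgebra ↔ ∀ d, coeff d f ≠ 0 → d.support ⊆ A.vars := by
  rw [subalgebra, proj_eq, mem_range_coordProj]

theorem monomial_mem_subalgebra {A : GradedRetract K n} {d : Fin n →₀ ℕ} (hd : d.support ⊆ A.vars)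
    (r : K) : monomial d r ∈ A.subalgebra := by
  classical
  rw [mem_subalgebra]
  intro e he
  rw [coeff_monomial] at he
  rwa [← (ite_ne_right_iff.1 he).1]

/-- The retraction `R → A` as a map of `R`-modules. -/
noncomputable def toAsModule (A : GradedRetract K n) :
    MvPolynomial (Fin n) K →ₗ[MvPolynomial (Fin n) K] A.AsModule where
  toFun r := A.proj.rangeRestrict r
  map_add' := map_add _
  map_smul' r s := map_mul A.proj.rangeRestrict r s

/-- Turns questions about regular sequences on a retract into questions about ideals of R. -/
noncomputable def asModuleEquiv (A : GradedRetract K n) :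
    (MvPolynomial (Fin n) K ⧸ coordIdeal K A.vars) ≃ₗ[MvPolynomial (Fin n) K] A.AsModule :=
  (Submodule.quotEquivOfEq _ _ (by
    ext f
    rw [← coordProj_eq_zero_iff, ← proj_eq, LinearMap.mem_ker]
    exact (Subtype.ext_iff (a1 := A.proj.rangeRestrict f) (a2 := 0)).symm)).trans
    (A.toAsModule.quotKerEquivOfSurjective A.proj.rangeRestrict_surjective)

end GradedRetract

end Retract

/-! ### Regular sequences on finite direct sums -/

section DirectSum

open DirectSum

variable {S : Type u} [CommRing S] {ι : Type*} [Fintype ι] [DecidableEq ι] {N : ι → Type v}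
  [∀ i, AddCommGroup (N i)] [∀ i, Module S (N i)]

theorem mem_smul_top_directSum {I : Ideal S} {x : ⨁ i, N i} :
    x ∈ (I • ⊤ : Submodule S (⨁ i, N i)) ↔ ∀ i, x i ∈ (I • ⊤ : Submodule S (N i)) := by
  constructor
  · intro hx i
    have h := Submodule.mem_map_of_mem (f := DirectSum.component S ι N i) hx
    rw [Submodule.map_smul''] at h
    exact Submodule.smul_mono le_rfl le_top h
  · intro h
    rw [← DirectSum.sum_univ_of x]
    refine Submodule.sum_mem _ fun i _ => ?_
    have h' := Submodule.mem_map_of_mem (f := DirectSum.lof S ι N i) (h i)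
    rw [Submodule.map_smul''] at h'
    exact Submodule.smul_mono le_rfl le_top h'

theorem isWeaklyRegular_directSum_iff {rs : List S} :
    RingTheory.Sequence.IsWeaklyRegular (⨁ i, N i) rs ↔
      ∀ i, RingTheory.Sequence.IsWeaklyRegular (N i) rs := by
  simp only [RingTheory.Sequence.isWeaklyRegular_iff, isSMulRegular_quotient_iff_mem_of_smul_mem,
    mem_smul_top_directSum]
  constructor
  · intro h i k hk x hx
    have := h k hk (DirectSum.of N i x) (fun j => ?_) i
    · rwa [DirectSum.of_eq_same] at this
    · by_cases hj : i = j
      · subst hj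
        rw [DirectSum.smul_apply, DirectSum.of_eq_same]
        exact hx
      · rw [DirectSum.smul_apply, DirectSum.of_eq_of_ne _ _ _ (Ne.symm hj), smul_zero]
        exact zero_mem _
  · intro h k hk x hx i
    exact h i k hk (x i) (hx i)

end DirectSum

/-! ### Upper bound for the depth by dimension -/

section Dimension

open RingTheory.Sequence Module Ideal

/-- A regular element avoids the minimal primes of the support, so each quotient lowers the
dimension by at least one. -/
theorem supportDim_add_length_le {R : Type u} [CommRing R] {M : Type v} [AddCommGroup M]
    [Module R M] [Module.Finite R M] (rs : List R) (reg : IsWeaklyRegular M rs) :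
    supportDim R (M ⧸ (ofList rs • ⊤ : Submodule R M)) + rs.length ≤ supportDim R M := by
  induction rs generalizing M with
  | nil =>
    rw [ofList_nil, Submodule.bot_smul]
    simpa using (supportDim_eq_of_equiv (Submodule.quotEquivOfEqBot ⊥ rfl)).le
  | cons x rs ih =>
    rw [isWeaklyRegular_cons_iff] at reg
    rw [supportDim_eq_of_equiv (Submodule.quotOfListConsSMulTopEquivQuotSMulTopInner M x rs),
      List.length_cons, Nat.cast_add, Nat.cast_one, ← add_assoc]
    have h := supportDim_quotSMulTop_succ_le_of_notMem_minimalPrimes (M := M) (x := x)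
      fun _ => reg.1.notMem_of_mem_minimalPrimes
    exact (add_le_add_left (ih reg.2) 1).trans h

end Dimension

variable {K : Type u} [Field K] {n : ℕ}

theorem ringKrullDim_quotient_coordIdeal_le (Z : Finset (Fin n)) :
    ringKrullDim (MvPolynomial (Fin n) K ⧸ coordIdeal K Z) ≤ Z.card := by
  let f : MvPolynomial Z K →ₐ[K] MvPolynomial (Fin n) K ⧸ coordIdeal K Z :=
    aeval fun i => Ideal.Quotient.mkₐ K _ (X i.1)
  have hf : Function.Surjective f := by
    rw [← AlgHom.range_eq_top, ← top_le_iff, ← (AlgHom.range_eq_top _).2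
      (Ideal.Quotient.mkₐ_surjective K (coordIdeal K Z)), ← Algebra.map_top,
      ← MvPolynomial.adjoin_range_X, AlgHom.map_adjoin, Algebra.adjoin_le_iff]
    rintro _ ⟨_, ⟨i, rfl⟩, rfl⟩
    by_cases hi : i ∈ Z
    · exact ⟨X ⟨i, hi⟩, by simp [f]⟩
    · have : X i ∈ coordIdeal K Z := Ideal.subset_span ⟨i, hi, rfl⟩
      rw [← Ideal.Quotient.eq_zero_iff_mem] at this
      rw [show (Ideal.Quotient.mkₐ K (coordIdeal K Z)) (X i) = 0 from this]
      exact zero_mem _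
  refine (ringKrullDim_le_of_surjective f.toRingHom hf).trans ?_
  rw [MvPolynomial.ringKrullDim_of_isNoetherianRing, ringKrullDim_eq_zero_of_field]
  simp

theorem coordIdeal_le_idealOfVars (Z : Finset (Fin n)) :
    coordIdeal K Z ≤ idealOfVars (Fin n) K :=
  Ideal.span_mono (Set.image_subset_range _ _)

theorem idealOfVars_ne_top : idealOfVars (Fin n) K ≠ ⊤ := by
  intro h
  have := (C_mem_pow_idealOfVars_iff (σ := Fin n) (R := K) 1 1).1 (by rw [pow_one, h]; trivial)
  simp at this

theorem smul_top_quotient_coordIdeal_ne_top {I : Ideal (MvPolynomial (Fin n) K)}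
    (hI : I ≤ idealOfVars (Fin n) K) (Z : Finset (Fin n)) :
    (I • ⊤ : Submodule (MvPolynomial (Fin n) K) (MvPolynomial (Fin n) K ⧸ coordIdeal K Z)) ≠ ⊤ := by
  intro h
  have h1 : (Submodule.map (coordIdeal K Z).mkQ I) = ⊤ := by
    conv_lhs => rw [show I = I • (⊤ : Ideal (MvPolynomial (Fin n) K)) by simp]
    rw [Submodule.map_smul'', Submodule.map_top, Submodule.range_mkQ, h]
  have h2 : I ⊔ coordIdeal K Z = ⊤ := by
    have := congrArg (Submodule.comap (coordIdeal K Z).mkQ) h1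
    rwa [Submodule.comap_map_mkQ, Submodule.comap_top, sup_comm] at this
  exact idealOfVars_ne_top (top_le_iff.1 (h2 ▸ sup_le hI (coordIdeal_le_idealOfVars Z)))

theorem length_le_of_isWeaklyRegular {Z : Finset (Fin n)} {rs : List (MvPolynomial (Fin n) K)}
    (hrs : ∀ r ∈ rs, r ∈ idealOfVars (Fin n) K)
    (h : RingTheory.Sequence.IsWeaklyRegular (MvPolynomial (Fin n) K ⧸ coordIdeal K Z) rs) :
    rs.length ≤ Z.card := by
  have h1 := supportDim_add_length_le rs h
  rw [Module.supportDim_quotient_eq_ringKrullDim] at h1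
  have h2 := h1.trans (ringKrullDim_quotient_coordIdeal_le Z)
  have : Nontrivial ((MvPolynomial (Fin n) K ⧸ coordIdeal K Z) ⧸
      (Ideal.ofList rs • ⊤ : Submodule (MvPolynomial (Fin n) K)
        (MvPolynomial (Fin n) K ⧸ coordIdeal K Z))) :=
    Submodule.Quotient.nontrivial_iff.2
      (smul_top_quotient_coordIdeal_ne_top (Ideal.span_le.2 hrs) Z)
  have h3 : (0 : WithBot ℕ∞) ≤ Module.supportDim (MvPolynomial (Fin n) K)
      ((MvPolynomial (Fin n) K ⧸ coordIdeal K Z) ⧸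
      (Ideal.ofList rs • ⊤ : Submodule (MvPolynomial (Fin n) K)
        (MvPolynomial (Fin n) K ⧸ coordIdeal K Z))) := by
    have := Module.supportDim_ne_bot_of_nontrivial (MvPolynomial (Fin n) K)
      ((MvPolynomial (Fin n) K ⧸ coordIdeal K Z) ⧸
      (Ideal.ofList rs • ⊤ : Submodule (MvPolynomial (Fin n) K)
        (MvPolynomial (Fin n) K ⧸ coordIdeal K Z)))
    obtain ⟨a, ha⟩ := WithBot.ne_bot_iff_exists.1 this
    rw [← ha]
    exact WithBot.coe_le_coe.2 zero_le
  have h4 := (le_add_of_nonneg_left h3).trans h2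
  exact_mod_cast h4

/-- The depth of a finite direct sum of retracts is at most the number of variables of each. -/
theorem moduleDepth_le_card_vars {N : ℕ} (A : Fin N → GradedRetract K n) (i : Fin N) :
    moduleDepth (idealOfVars (Fin n) K) (DirectSum (Fin N) fun i => (A i).AsModule) ≤
      ((A i).vars.card : ℕ∞) := by
  refine sSup_le ?_
  rintro _ ⟨rs, hrs, hreg, rfl⟩
  have h := isWeaklyRegular_directSum_iff.1 hreg.toIsWeaklyRegular i
  rw [← (A i).asModuleEquiv.isWeaklyRegular_congr] at h
  exact_mod_cast length_le_of_isWeaklyRegular hrs h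

theorem le_moduleDepth {N : ℕ} (hN : 0 < N) (A : Fin N → GradedRetract K n)
    (rs : List (MvPolynomial (Fin n) K)) (hrs : ∀ r ∈ rs, r ∈ idealOfVars (Fin n) K)
    (h : ∀ i, RingTheory.Sequence.IsWeaklyRegular
      (MvPolynomial (Fin n) K ⧸ coordIdeal K (A i).vars) rs) :
    (rs.length : ℕ∞) ≤
      moduleDepth (idealOfVars (Fin n) K) (DirectSum (Fin N) fun i => (A i).AsModule) := by
  refine le_sSup ⟨rs, hrs, ⟨isWeaklyRegular_directSum_iff.2 fun i => ?_, fun htop => ?_⟩, rfl⟩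
  · rw [← (A i).asModuleEquiv.isWeaklyRegular_congr]
    exact h i
  · let i : Fin N := ⟨0, hN⟩
    refine smul_top_quotient_coordIdeal_ne_top (Ideal.span_le.2 hrs) (A i).vars ?_
    have h1 : (Ideal.ofList rs • ⊤ : Submodule (MvPolynomial (Fin n) K) (A i).AsModule) = ⊤ := by
      rw [eq_top_iff]
      intro x _
      have hx : DirectSum.of (fun i => (A i).AsModule) i x ∈
        (⊤ : Submodule (MvPolynomial (Fin n) K) (DirectSum (Fin N) fun i => (A i).AsModule)) := trivial
      rw [htop] at hx
      simpa using mem_smul_top_directSum.1 hx i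
    have h2 := congrArg (Submodule.map (A i).asModuleEquiv.symm.toLinearMap) h1
    rwa [Submodule.map_smul'', Submodule.map_top, LinearEquiv.range] at h2

/-! ### Regular sequences expressed through ideals -/

section IdealRegular

open scoped Pointwise

variable {R : Type u} [CommRing R]

/-- The list `rs` is a weakly regular sequence on `R ⧸ J`, in terms of elements of `R`. -/
def IsRegularModulo : Ideal R → List R → Prop
  | _, [] => True
  | J, a :: l => (∀ f, a * f ∈ J → f ∈ J) ∧ IsRegularModulo (J ⊔ Ideal.span {a}) l

/-- Induction through the isomorphism of R ⧸ (J + (a)) with (R ⧸ J) ⧸ a(R ⧸ J). -/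
theorem IsRegularModulo.isWeaklyRegular {J : Ideal R} {l : List R} (h : IsRegularModulo J l) :
    RingTheory.Sequence.IsWeaklyRegular (R ⧸ J) l := by
  induction l generalizing J with
  | nil => exact RingTheory.Sequence.IsWeaklyRegular.nil R _
  | cons a l ih =>
    rw [RingTheory.Sequence.isWeaklyRegular_cons_iff, isSMulRegular_quotient_iff_mem_of_smul_mem]
    refine ⟨h.1, ?_⟩
    have hle : J ≤ LinearMap.ker ((Submodule.mkQ (a • ⊤ : Submodule R (R ⧸ J))).comp J.mkQ) := by
      intro x hx
      have : J.mkQ x = 0 := (Submodule.Quotient.mk_eq_zero J).2 hx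
      simp [this]
    have hker : LinearMap.ker ((Submodule.mkQ (a • ⊤ : Submodule R (R ⧸ J))).comp J.mkQ) =
        J ⊔ Ideal.span {a} := by
      rw [LinearMap.ker_comp, Submodule.ker_mkQ, ← Submodule.range_mkQ J, ← Submodule.map_top,
        ← Submodule.map_pointwise_smul, Submodule.comap_map_mkQ,
        ← Submodule.ideal_span_singleton_smul]
      simp
    have e := (Submodule.quotEquivOfEq _ _ hker.symm).trans
      (LinearMap.quotKerEquivOfSurjective ((Submodule.mkQ (a • ⊤ : Submodule R (R ⧸ J))).comp J.mkQ)
        ((Submodule.mkQ_surjective _).comp (Submodule.mkQ_surjective _)))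
    exact (e.isWeaklyRegular_congr l).1 (ih h.2)

theorem isRegularModulo_append_singleton {J : Ideal R} {l : List R} {x : R} :
    IsRegularModulo J (l ++ [x]) ↔ IsRegularModulo J l ∧
      ∀ f, x * f ∈ J ⊔ Ideal.ofList l → f ∈ J ⊔ Ideal.ofList l := by
  induction l generalizing J with
  | nil => simp [IsRegularModulo]
  | cons a l ih =>
    rw [List.cons_append, IsRegularModulo, ih, IsRegularModulo, Ideal.ofList_cons, sup_assoc,
      and_assoc]

end IdealRegular

/-! ### Permuting regular sequences modulo a graded ideal -/

section Graded

variable {K : Type u} [Field K] {n : ℕ}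

/-- An ideal containing the homogeneous components of its elements is closed in the topology
defined by the powers of the ideal of the variables. -/
theorem mem_of_forall_mem_sup_pow {J : Ideal (MvPolynomial (Fin n) K)}
    (hJ : ∀ f ∈ J, ∀ k, homogeneousComponent k f ∈ J) {f : MvPolynomial (Fin n) K}
    (h : ∀ N, f ∈ J ⊔ idealOfVars (Fin n) K ^ N) : f ∈ J := by
  rw [← sum_homogeneousComponent f]
  refine sum_mem fun k _ => ?_
  obtain ⟨g, hg, p, hp, rfl⟩ := Submodule.mem_sup.1 (h (k + 1))
  rw [mem_pow_idealOfVars_iff'] at hp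
  have : homogeneousComponent k p = 0 := by
    ext d
    rw [coeff_homogeneousComponent, coeff_zero]
    split_ifs with hd
    · exact hp d (by omega)
    · rfl
  rw [map_add, this, add_zero]
  exact hJ g hg k

theorem homogeneousComponent_mul_of_isHomogeneous {a f : MvPolynomial (Fin n) K} {i k : ℕ}
    (ha : a.IsHomogeneous i) :
    homogeneousComponent (i + k) (a * f) = a * homogeneousComponent k f := by
  classical
  conv_lhs => rw [← sum_homogeneousComponent f, Finset.mul_sum, map_sum]
  have h : ∀ j, homogeneousComponent (i + k) (a * homogeneousComponent j f) =
      if j = k then a * homogeneousComponent k f else 0 := by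
    intro j
    rw [homogeneousComponent_of_mem ((mem_homogeneousSubmodule _ _).2
      (ha.mul (homogeneousComponent_isHomogeneous j f)))]
    by_cases hj : j = k
    · simp [hj]
    · rw [if_neg hj, if_neg (by omega)]
  rw [Finset.sum_congr rfl fun j _ => h j, Finset.sum_ite_eq']
  split_ifs with hk
  · rfl
  · rw [homogeneousComponent_eq_zero _ _ (by simpa using hk), mul_zero]

theorem homogeneousComponent_mem_sup_span {J : Ideal (MvPolynomial (Fin n) K)}
    (hJ : ∀ f ∈ J, ∀ k, homogeneousComponent k f ∈ J) {a : MvPolynomial (Fin n) K} {i : ℕ}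
    (ha : a.IsHomogeneous i) : ∀ f ∈ J ⊔ Ideal.span {a}, ∀ k,
      homogeneousComponent k f ∈ J ⊔ Ideal.span {a} := by
  intro f hf k
  obtain ⟨g, hg, p, hp, rfl⟩ := Submodule.mem_sup.1 hf
  obtain ⟨q, rfl⟩ := Ideal.mem_span_singleton'.1 hp
  rw [map_add]
  refine add_mem (Ideal.mem_sup_left (hJ g hg k)) (Ideal.mem_sup_right ?_)
  rw [mul_comm]
  rcases le_or_gt i k with hk | hk
  · obtain ⟨j, rfl⟩ := Nat.exists_eq_add_of_le hk
    rw [homogeneousComponent_mul_of_isHomogeneous ha]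
    exact Ideal.mul_mem_right _ _ (Ideal.mem_span_singleton_self a)
  · have : homogeneousComponent k (a * q) = 0 := by
      conv_lhs => rw [← sum_homogeneousComponent q, Finset.mul_sum, map_sum]
      refine Finset.sum_eq_zero fun j _ => ?_
      rw [homogeneousComponent_of_mem ((mem_homogeneousSubmodule _ _).2
        (ha.mul (homogeneousComponent_isHomogeneous j q))), if_neg (by omega)]
    rw [this]
    exact zero_mem _

/-- The usual proof for local rings, with separatedness of the grading in place of Nakayama's lemma.
-/
theorem IsRegularModulo.swap {J : Ideal (MvPolynomial (Fin n) K)}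
    (hJ : ∀ f ∈ J, ∀ k, homogeneousComponent k f ∈ J) {a b : MvPolynomial (Fin n) K}
    {l : List (MvPolynomial (Fin n) K)} (ha : a ∈ idealOfVars (Fin n) K)
    (h : IsRegularModulo J (a :: b :: l)) : IsRegularModulo J (b :: a :: l) := by
  obtain ⟨h1, h2, h3⟩ := h
  have key : ∀ f, b * f ∈ J → ∃ g, b * g ∈ J ∧ f - a * g ∈ J := by
    intro f hf
    obtain ⟨j, hj, p, hp, hjp⟩ := Submodule.mem_sup.1 (h2 f (Ideal.mem_sup_left hf))
    obtain ⟨g, rfl⟩ := Ideal.mem_span_singleton'.1 hp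
    refine ⟨g, h1 _ ?_, by rw [← hjp]; convert hj using 1; ring⟩
    rw [show a * (b * g) = b * f - b * j by rw [← hjp]; ring]
    exact sub_mem hf (Ideal.mul_mem_left _ _ hj)
  -- Iterating `key` writes f modulo J as a multiple of ever higher powers of a; since J is graded,
  -- it is closed and contains f.
  have hpow : ∀ N f, b * f ∈ J → f ∈ J ⊔ idealOfVars (Fin n) K ^ N := by
    intro N
    induction N with
    | zero => simp
    | succ N ih =>
      intro f hf
      obtain ⟨g, hg, hfg⟩ := key f hf
      obtain ⟨j, hj, p, hp, hjp⟩ := Submodule.mem_sup.1 (ih g hg)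
      rw [show f = ((f - a * g) + a * j) + a * p by rw [← hjp]; ring, pow_succ']
      exact add_mem (Ideal.mem_sup_left (add_mem hfg (Ideal.mul_mem_left _ _ hj)))
        (Ideal.mem_sup_right (Ideal.mul_mem_mul ha hp))
  have hb : ∀ f, b * f ∈ J → f ∈ J := fun f hf =>
    mem_of_forall_mem_sup_pow hJ fun N => hpow N f hf
  refine ⟨hb, fun f hf => ?_, by rwa [sup_right_comm]⟩
  obtain ⟨j, hj, p, hp, hjp⟩ := Submodule.mem_sup.1 hf
  obtain ⟨g, rfl⟩ := Ideal.mem_span_singleton'.1 hp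
  have hg : b * g ∈ J ⊔ Ideal.span {a} := by
    rw [show b * g = a * f - j by rw [← hjp]; ring]
    exact sub_mem (Ideal.mem_sup_right (Ideal.mul_mem_right _ _ (Ideal.mem_span_singleton_self a)))
      (Ideal.mem_sup_left hj)
  obtain ⟨j', hj', p', hp', hg'⟩ := Submodule.mem_sup.1 (h2 g hg)
  obtain ⟨q, rfl⟩ := Ideal.mem_span_singleton'.1 hp'
  have hmem : f - b * q ∈ J := by
    refine h1 _ ?_
    rw [show a * (f - b * q) = j + b * j' by linear_combination -hjp - b * hg']
    exact add_mem hj (Ideal.mul_mem_left _ _ hj')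
  rw [show f = (f - b * q) + b * q by ring]
  exact add_mem (Ideal.mem_sup_left hmem)
    (Ideal.mem_sup_right (Ideal.mul_mem_right _ _ (Ideal.mem_span_singleton_self b)))

/-- Carries x to the end by successive swaps. Homogeneity of the list keeps each ideal J + (a)
graded, as the next swap requires. -/
theorem IsRegularModulo.append_singleton_of_cons {J : Ideal (MvPolynomial (Fin n) K)}
    (hJ : ∀ f ∈ J, ∀ k, homogeneousComponent k f ∈ J) {x : MvPolynomial (Fin n) K}
    {l : List (MvPolynomial (Fin n) K)} (hx : x ∈ idealOfVars (Fin n) K)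
    (hl : ∀ a ∈ l, ∃ i, a.IsHomogeneous i) (h : IsRegularModulo J (x :: l)) :
    IsRegularModulo J (l ++ [x]) := by
  induction l generalizing J with
  | nil => exact h
  | cons a l ih =>
    obtain ⟨i, hi⟩ := hl a List.mem_cons_self
    obtain ⟨h1, h2⟩ := h.swap hJ hx
    exact ⟨h1, ih (homogeneousComponent_mem_sup_span hJ hi)
      (fun b hb => hl b (List.mem_cons_of_mem _ hb)) h2⟩

end Graded

/-! ### Elementary symmetric polynomials as a common regular sequence -/

section Esymm

variable (K : Type u) [Field K] (n : ℕ)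

/-- The elementary symmetric polynomials of degree `1, …, k`. -/
noncomputable def esymmList (k : ℕ) : List (MvPolynomial (Fin n) K) :=
  (List.range k).map fun i => esymm (Fin n) K (i + 1)

theorem esymmList_succ (k : ℕ) :
    esymmList K n (k + 1) = esymmList K n k ++ [esymm (Fin n) K (k + 1)] := by
  simp [esymmList, List.range_succ]

variable {K n}

theorem isHomogeneous_of_mem_esymmList {k : ℕ} {f : MvPolynomial (Fin n) K}
    (hf : f ∈ esymmList K n k) : ∃ i, f.IsHomogeneous (i + 1) := by
  obtain ⟨i, -, rfl⟩ := List.mem_map.1 hf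
  refine ⟨i, ?_⟩
  rw [esymm]
  refine IsHomogeneous.sum _ _ _ fun t ht => ?_
  have := IsHomogeneous.prod t (fun i => (X i : MvPolynomial (Fin n) K)) (fun _ => 1)
    fun j _ => isHomogeneous_X _ _
  simpa [(Finset.mem_powersetCard.1 ht).2] using this

theorem mem_idealOfVars_of_mem_esymmList {k : ℕ} {f : MvPolynomial (Fin n) K}
    (hf : f ∈ esymmList K n k) : f ∈ idealOfVars (Fin n) K := by
  obtain ⟨i, hi⟩ := isHomogeneous_of_mem_esymmList hf
  rw [← pow_one (idealOfVars (Fin n) K), mem_pow_idealOfVars_iff']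
  intro d hd
  exact hi.coeff_eq_zero (by omega)

theorem coordIdeal_homogeneous (Z : Finset (Fin n)) :
    ∀ f ∈ coordIdeal K Z, ∀ k, homogeneousComponent k f ∈ coordIdeal K Z := by
  intro f hf k
  rw [mem_coordIdeal] at hf ⊢
  intro d hd
  rw [coeff_homogeneousComponent, hf d hd, ite_self]

theorem X_mul_mem_coordIdeal {Z : Finset (Fin n)} {i : Fin n} (hi : i ∈ Z)
    {f : MvPolynomial (Fin n) K} (h : X i * f ∈ coordIdeal K Z) : f ∈ coordIdeal K Z := by
  rw [mem_coordIdeal] at h ⊢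
  intro d hd
  rw [← coeff_X_mul (m := d) (s := i)]
  refine h _ (Finsupp.support_add.trans (Finset.union_subset ?_ hd))
  exact Finsupp.support_single_subset.trans (by simpa using hi)

theorem coordIdeal_sup_span_X (Z : Finset (Fin n)) (i : Fin n) :
    coordIdeal K Z ⊔ Ideal.span {X i} = coordIdeal K (Z.erase i) := by
  rw [coordIdeal, coordIdeal, ← Ideal.span_union, ← Set.image_singleton, ← Set.image_union]
  congr 2
  ext j
  simp only [Set.mem_union, Set.mem_ofPred_eq, Set.mem_singleton_iff, Finset.mem_erase]
  tauto

theorem esymm_card_sub_prod_mem (Z : Finset (Fin n)) :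
    esymm (Fin n) K Z.card - ∏ i ∈ Z, X i ∈ coordIdeal K Z := by
  classical
  rw [esymm, ← Finset.sum_erase_eq_sub (Finset.mem_powersetCard.2 ⟨Finset.subset_univ Z, rfl⟩)]
  refine sum_mem fun t ht => ?_
  obtain ⟨htZ, ht⟩ := Finset.mem_erase.1 ht
  obtain ⟨i, hi, hiZ⟩ := Finset.not_subset.1 fun hs =>
    htZ (Finset.eq_of_subset_of_card_le hs (Finset.mem_powersetCard.1 ht).2.ge)
  exact Ideal.mem_of_dvd _ (Finset.dvd_prod_of_mem _ hi) (Ideal.subset_span ⟨i, hiZ, rfl⟩)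

/-- Induction on |Z|: killing xᵢ with i ∈ Z passes to K[Z \ {i}], where e₁, …, eⱼ is regular for j <
|Z|. The top polynomial e_{|Z|} becomes the product of the variables in Z, each of which is regular
modulo the preceding ones. -/
theorem isRegularModulo_esymmList {Z : Finset (Fin n)} {k : ℕ} (hk : k ≤ Z.card) :
    IsRegularModulo (coordIdeal K Z) (esymmList K n k) := by
  induction hm : Z.card generalizing Z k with
  | zero =>
    obtain rfl : k = 0 := by omega
    trivial
  | succ m ih =>
    -- The sequence xᵢ, e₁, …, eⱼ is regular by induction; then xᵢ is moved to the end.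
    have hX : ∀ i ∈ Z, ∀ j ≤ m, IsRegularModulo (coordIdeal K Z) (esymmList K n j ++ [X i]) := by
      intro i hi j hj
      refine IsRegularModulo.append_singleton_of_cons (coordIdeal_homogeneous Z)
        (Ideal.subset_span ⟨i, rfl⟩)
        (fun a ha => (isHomogeneous_of_mem_esymmList ha).elim fun i h => ⟨i + 1, h⟩) ?_
      · refine ⟨fun f => X_mul_mem_coordIdeal hi, ?_⟩
        rw [coordIdeal_sup_span_X]
        have hc : (Z.erase i).card = m := by rw [Finset.card_erase_of_mem hi, hm]; rfl
        exact ih (by omega) hc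
    rcases Nat.lt_or_ge m k with hmk | hmk
    · obtain rfl : k = m + 1 := by omega
      obtain ⟨i, hi⟩ : Z.Nonempty := Finset.card_pos.1 (by omega)
      rw [esymmList_succ, isRegularModulo_append_singleton]
      refine ⟨(isRegularModulo_append_singleton.1 (hX i hi m le_rfl)).1, fun f hf => ?_⟩
      have h1 : (∏ i ∈ Z, X i) * f ∈ coordIdeal K Z ⊔ Ideal.ofList (esymmList K n m) := by
        have := Ideal.mul_mem_right f _ (esymm_card_sub_prod_mem (K := K) Z)
        rw [hm] at this
        rw [show (∏ i ∈ Z, X i) * f = esymm (Fin n) K (m + 1) * f -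
          (esymm (Fin n) K (m + 1) - ∏ i ∈ Z, X i) * f by ring]
        exact sub_mem hf (Ideal.mem_sup_left this)
      -- The variables of the product are cancelled one at a time.
      have h2 : ∀ W ⊆ Z, (∏ i ∈ W, X i) * f ∈ coordIdeal K Z ⊔ Ideal.ofList (esymmList K n m) →
          f ∈ coordIdeal K Z ⊔ Ideal.ofList (esymmList K n m) := by
        intro W
        induction W using Finset.induction_on with
        | empty => simp
        | insert a W ha ihW =>
          intro hW hf
          rw [Finset.prod_insert ha, mul_assoc] at hf
          exact ihW ((Finset.subset_insert _ _).trans hW)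
            ((isRegularModulo_append_singleton.1 (hX a (hW (Finset.mem_insert_self _ _)) m
              le_rfl)).2 _ hf)
      exact h2 Z subset_rfl h1
    · obtain ⟨i, hi⟩ : Z.Nonempty := Finset.card_pos.1 (by omega)
      exact (isRegularModulo_append_singleton.1 (hX i hi k hmk)).1

/-- A finite direct sum of retracts, each with at least `c` variables, has depth at least `c`. -/
theorem le_moduleDepth_of_le_card_vars {N c : ℕ} (hN : 0 < N) (A : Fin N → GradedRetract K n)
    (h : ∀ i, c ≤ (A i).vars.card) :
    (c : ℕ∞) ≤
      moduleDepth (idealOfVars (Fin n) K) (DirectSum (Fin N) fun i => (A i).AsModule) := by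
  have := le_moduleDepth hN A (esymmList K n c) (fun r => mem_idealOfVars_of_mem_esymmList)
    fun i => (isRegularModulo_esymmList (h i)).isWeaklyRegular
  simpa [esymmList] using this

end Esymm

/-! ### Stanley decompositions from interval partitions -/

theorem isInternal_iff_forall_exists {K : Type u} [Field K] {M : Type v} [AddCommGroup M]
    [Module K M] {N : ℕ} {P : Fin N → Submodule K M} :
    DirectSum.IsInternal P ↔
      (∀ v, ∃ f : Fin N → M, (∀ i, f i ∈ P i) ∧ ∑ i, f i = v) ∧
      ∀ f : Fin N → M, (∀ i, f i ∈ P i) → ∑ i, f i = 0 → ∀ i, f i = 0 := by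
  have hsum : ∀ x : DirectSum (Fin N) fun i => P i,
      DirectSum.coeAddMonoidHom P x = ∑ i, (x i : M) := by
    intro x
    conv_lhs => rw [← DirectSum.sum_univ_of x, map_sum]
    simp only [DirectSum.coeAddMonoidHom_of]
  have hmk : ∀ (f : Fin N → M) (hf : ∀ i, f i ∈ P i),
      ∃ x : DirectSum (Fin N) fun i => P i, ∀ i, (x i : M) = f i := by
    intro f hf
    refine ⟨∑ i, DirectSum.of (fun i => P i) i ⟨f i, hf i⟩, fun i => ?_⟩
    rw [DFinsupp.finsetSum_apply, Finset.sum_eq_single i]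
    · erw [DirectSum.of_eq_same]
    · intro j _ hj
      exact DirectSum.of_eq_of_ne _ _ _ hj.symm
    · simp
  rw [DirectSum.IsInternal, Function.Bijective, and_comm, injective_iff_map_eq_zero]
  refine and_congr (forall_congr' fun v => ⟨?_, ?_⟩) ⟨?_, ?_⟩
  · rintro ⟨x, rfl⟩
    exact ⟨fun i => x i, fun i => (x i).2, (hsum x).symm⟩
  · rintro ⟨f, hf, rfl⟩
    obtain ⟨x, hx⟩ := hmk f hf
    exact ⟨x, by rw [hsum]; exact Finset.sum_congr rfl fun i _ => hx i⟩
  · intro h f hf h0 i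
    obtain ⟨x, hx⟩ := hmk f hf
    have := h x (by rw [hsum, ← h0]; exact Finset.sum_congr rfl fun i _ => hx i)
    rw [← hx, this]
    rfl
  · intro h x hx
    rw [hsum] at hx
    refine DFinsupp.ext fun i => Subtype.ext ?_
    exact h (fun i => x i) (fun i => (x i).2) hx i

theorem mem_retractSpan {K : Type u} [Field K] {n : ℕ} {M : Type v} [AddCommGroup M]
    [Module (MvPolynomial (Fin n) K) M] [Module K M] [IsScalarTower K (MvPolynomial (Fin n) K) M]
    {A : GradedRetract K n} {u v : M} :
    v ∈ retractSpan A u ↔ ∃ r ∈ A.subalgebra, r • u = v := Iff.rfl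

section IntervalDecomposition

variable {K : Type u} [Field K] {n : ℕ}

theorem mem_idealOfVars_iff {f : MvPolynomial (Fin n) K} :
    f ∈ idealOfVars (Fin n) K ↔ coeff 0 f = 0 := by
  rw [← pow_one (idealOfVars (Fin n) K), mem_pow_idealOfVars_iff']
  refine ⟨fun h => h 0 (by simp), fun h d hd => ?_⟩
  rwa [(Finsupp.degree_eq_zero_iff d).1 (by omega)]

/-- The part of a polynomial supported on the exponents in `s`. -/
theorem exists_coeff_eq_ite (f : MvPolynomial (Fin n) K) (s : (Fin n →₀ ℕ) → Prop)
    [DecidablePred s] :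
    ∃ g : MvPolynomial (Fin n) K, ∀ d, coeff d g = if s d then coeff d f else 0 := by
  classical
  refine ⟨∑ d ∈ f.support with s d, monomial d (coeff d f), fun d => ?_⟩
  rw [coeff_sum]
  simp only [coeff_monomial, Finset.sum_ite_eq', Finset.mem_filter, mem_support_iff]
  grind

/-- The exponent of the squarefree monomial with support `A`. -/
noncomputable def indicatorExponent (A : Finset (Fin n)) : Fin n →₀ ℕ :=
  Finsupp.equivFunOnFinite.symm fun i => if i ∈ A then 1 else 0

theorem indicatorExponent_apply (A : Finset (Fin n)) (i : Fin n) :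
    indicatorExponent A i = if i ∈ A then 1 else 0 := rfl

theorem indicatorExponent_le_iff {A : Finset (Fin n)} {d : Fin n →₀ ℕ} :
    indicatorExponent A ≤ d ↔ A ⊆ d.support := by
  rw [Finsupp.le_def]
  refine forall_congr' fun i => ?_
  rw [indicatorExponent_apply, Finsupp.mem_support_iff]
  split_ifs with h <;> simp [h, Nat.one_le_iff_ne_zero]

theorem monomial_indicatorExponent_mem {A : Finset (Fin n)} (hA : A.Nonempty) :
    (monomial (indicatorExponent A) 1 : MvPolynomial (Fin n) K) ∈ idealOfVars (Fin n) K := by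
  classical
  rw [mem_idealOfVars_iff, coeff_monomial, if_neg]
  intro h
  obtain ⟨i, hi⟩ := hA
  have := DFunLike.congr_fun h i
  simp [indicatorExponent_apply, hi] at this

/-- The summand x^A K[B] is spanned by the monomials whose support lies in [A, B]; this is where A ⊆
B is needed. -/
theorem mem_retractSpan_indicatorExponent {A B : Finset (Fin n)} (hA : A.Nonempty) (hAB : A ⊆ B)
    {f : idealOfVars (Fin n) K} :
    f ∈ retractSpan (GradedRetract.ofVars K B) (⟨_, monomial_indicatorExponent_mem hA⟩ :
      idealOfVars (Fin n) K) ↔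
      ∀ d, coeff d f.1 ≠ 0 → A ⊆ d.support ∧ d.support ⊆ B := by
  rw [mem_retractSpan]
  simp only [GradedRetract.mem_subalgebra, GradedRetract.vars_ofVars]
  constructor
  · rintro ⟨r, hr, rfl⟩ d hd
    rw [Submodule.coe_smul, smul_eq_mul, coeff_mul_monomial', mul_one] at hd
    obtain ⟨h1, h2⟩ := ite_ne_right_iff.1 hd
    refine ⟨indicatorExponent_le_iff.1 h1, fun i hi => ?_⟩
    by_cases hiA : i ∈ A
    · exact hAB hiA
    · refine hr _ h2 ?_
      rw [Finsupp.mem_support_iff] at hi ⊢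
      rwa [Finsupp.tsub_apply, indicatorExponent_apply, if_neg hiA]
  · intro h
    refine ⟨f.1.divMonomial (indicatorExponent A), fun d hd => ?_, Subtype.ext ?_⟩
    · rw [coeff_divMonomial] at hd
      refine Finset.Subset.trans (fun i hi => ?_) (h _ hd).2
      rw [Finsupp.mem_support_iff] at hi ⊢
      rw [Finsupp.add_apply]
      omega
    · rw [Submodule.coe_smul, smul_eq_mul]
      ext d
      rw [coeff_mul_monomial', mul_one]
      split_ifs with hd
      · rw [coeff_divMonomial, add_tsub_cancel_of_le hd]
      · by_contra hc
        exact hd (indicatorExponent_le_iff.2 (h d (Ne.symm hc)).1)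

/-- The Stanley decomposition of the ideal of the variables given by a partition of the nonempty
subsets of `Fin n` into intervals. -/
noncomputable def intervalDecomposition (K : Type u) [Field K] {n N : ℕ}
    (A B : Fin N → Finset (Fin n)) (hA : ∀ i, (A i).Nonempty) (hAB : ∀ i, A i ⊆ B i)
    (h : ∀ s : Finset (Fin n), s.Nonempty → ∃! i, A i ⊆ s ∧ s ⊆ B i) :
    StanleyDecomposition (maxIdealGrading K n) where
  size := N
  retract i := GradedRetract.ofVars K (B i)
  gen i := ⟨monomial (indicatorExponent (A i)) 1, monomial_indicatorExponent_mem (hA i)⟩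
  gen_homogeneous i := ⟨_, monomial_mem_multigrading _ _⟩
  ann_eq_zero i r _ hr0 := by
    have := Subtype.ext_iff.1 hr0
    rw [Submodule.coe_smul, smul_eq_mul] at this
    exact (mul_eq_zero.1 this).resolve_right (by simp)
  isInternal := by
    classical
    rw [isInternal_iff_forall_exists]
    simp only [mem_retractSpan_indicatorExponent (hA _) (hAB _)]
    constructor
    · intro f
      choose g hg using fun i : Fin N =>
        exists_coeff_eq_ite f.1 fun d => A i ⊆ d.support ∧ d.support ⊆ B i
      have hg0 : ∀ i, g i ∈ idealOfVars (Fin n) K := by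
        intro i
        rw [mem_idealOfVars_iff, hg, if_neg]
        rintro ⟨h1, -⟩
        exact (hA i).ne_empty (by simpa using h1)
      refine ⟨fun i => ⟨g i, hg0 i⟩, fun i d hd => ?_, Subtype.ext ?_⟩
      · rw [hg] at hd
        exact (ite_ne_right_iff.1 hd).1
      · rw [AddSubmonoidClass.coe_finsetSum]
        ext d
        rw [coeff_sum]
        simp only [hg]
        rcases d.support.eq_empty_or_nonempty with hd | hd
        · rw [Finsupp.support_eq_empty] at hd
          subst hd
          simp [mem_idealOfVars_iff.1 f.2]
        · obtain ⟨i, hi, hi'⟩ := h _ hd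
          rw [Finset.sum_eq_single i, if_pos hi]
          · exact fun j _ hj => if_neg fun hc => hj (hi' j hc)
          · simp
    · intro f hf h0 i
      refine Subtype.ext (MvPolynomial.ext _ _ fun d => ?_)
      by_contra hd
      have hdi := hf i d hd
      obtain ⟨k, -, hk'⟩ := h d.support ((hA i).mono hdi.1)
      have hsum := congrArg (coeff d) (Subtype.ext_iff.1 h0)
      rw [AddSubmonoidClass.coe_finsetSum, coeff_sum, Finset.sum_eq_single i] at hsum
      · exact hd hsum
      · intro j _ hj
        by_contra hc
        exact hj ((hk' j (hf j d hc)).trans (hk' i hdi).symm)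
      · simp

/-- A Stanley decomposition of `m` extended by the free summand `R` of `R ⊕ m`. -/
noncomputable def StanleyDecomposition.consFree
    (D : StanleyDecomposition (maxIdealGrading K n)) :
    StanleyDecomposition (directSumGrading K n) where
  size := D.size + 1
  retract := Fin.cons (GradedRetract.ofVars K Finset.univ) D.retract
  gen := Fin.cons (1, 0) fun i => (0, D.gen i)
  gen_homogeneous := by
    refine Fin.cases ⟨fun i => ((0 : Fin n →₀ ℕ) i : ℤ), ?_, ?_⟩ fun i => ?_
    · exact monomial_mem_multigrading 0 (1 : K)
    · exact zero_mem _
    · obtain ⟨a, ha⟩ := D.gen_homogeneous i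
      exact ⟨a, zero_mem _, ha⟩
  ann_eq_zero := by
    refine Fin.cases (fun r _ hr0 => ?_) fun i r hr hr0 => ?_
    · simpa using congrArg Prod.fst hr0
    · exact D.ann_eq_zero i r hr (congrArg Prod.snd hr0)
  isInternal := by
    have hD := isInternal_iff_forall_exists.1 D.isInternal
    have h0 : ∀ v : MvPolynomial (Fin n) K × idealOfVars (Fin n) K,
        v ∈ retractSpan (GradedRetract.ofVars K (Finset.univ : Finset (Fin n))) ((1, 0) :
          MvPolynomial (Fin n) K × idealOfVars (Fin n) K) ↔ v.2 = 0 := by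
      intro v
      rw [mem_retractSpan]
      constructor
      · rintro ⟨r, -, rfl⟩
        simp
      · intro hv
        refine ⟨v.1, ?_, Prod.ext (by simp) (by simp [hv])⟩
        rw [GradedRetract.mem_subalgebra, GradedRetract.vars_ofVars]
        exact fun d _ => Finset.subset_univ _
    have h1 : ∀ (i : Fin D.size) (v : MvPolynomial (Fin n) K × idealOfVars (Fin n) K),
        v ∈ retractSpan (D.retract i) ((0, D.gen i) :
          MvPolynomial (Fin n) K × idealOfVars (Fin n) K) ↔
          v.1 = 0 ∧ v.2 ∈ retractSpan (D.retract i) (D.gen i) := by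
      intro i v
      rw [mem_retractSpan, mem_retractSpan]
      constructor
      · rintro ⟨r, hr, rfl⟩
        exact ⟨by simp, r, hr, rfl⟩
      · rintro ⟨hv, r, hr, hrv⟩
        exact ⟨r, hr, Prod.ext (by simp [hv]) hrv⟩
    rw [isInternal_iff_forall_exists]
    simp only [Fin.forall_fin_succ, Fin.cons_zero, Fin.cons_succ, h0, h1, Fin.sum_univ_succ]
    constructor
    · rintro ⟨p, q⟩
      obtain ⟨f, hf, rfl⟩ := hD.1 q
      refine ⟨Fin.cons (p, 0) fun i => (0, f i), ⟨rfl, fun i => ⟨rfl, hf i⟩⟩, ?_⟩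
      simp only [Fin.cons_zero, Fin.cons_succ]
      ext1
      · simp [Prod.fst_sum]
      · simp [Prod.snd_sum]
    · rintro f ⟨hf0, hf⟩ hsum
      have hfst := congrArg Prod.fst hsum
      have hsnd := congrArg Prod.snd hsum
      rw [Prod.fst_add, Prod.fst_sum, Finset.sum_eq_zero fun i _ => (hf i).1, add_zero] at hfst
      rw [Prod.snd_add, Prod.snd_sum, hf0, zero_add] at hsnd
      exact ⟨Prod.ext hfst hf0, fun i =>
        Prod.ext (hf i).1 (hD.2 (fun i => (f i.succ).2) (fun i => (hf i).2) hsnd i)⟩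

end IntervalDecomposition

/-! ### Counting in the multigraded components of R ⊕ m -/

variable {K : Type u} [Field K] {n : ℕ}

namespace StanleyDecomposition

/-- A generator is nonzero because 1 lies in its retract, and degrees outside ℕⁿ have zero
component. -/
theorem exists_gen_eq_monomial (D : StanleyDecomposition (directSumGrading K n)) (i : Fin D.size) :
    ∃ (e : Fin n →₀ ℕ) (w : K × K), w ≠ 0 ∧ (D.gen i).1 = monomial e w.1 ∧
      ((D.gen i).2 : MvPolynomial (Fin n) K) = monomial e w.2 := by
  obtain ⟨a, h1, h2⟩ := D.gen_homogeneous i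
  have hne : D.gen i ≠ 0 := fun h0 =>
    one_ne_zero (D.ann_eq_zero i 1 (one_mem _) (by rw [h0, smul_zero]))
  have : ∃ e : Fin n →₀ ℕ, (fun j => (e j : ℤ)) = a := by
    by_contra hc
    push Not at hc
    refine hne (Prod.ext (MvPolynomial.ext _ _ fun d => ?_)
      (Subtype.ext (MvPolynomial.ext _ _ fun d => ?_)))
    · by_contra hd
      exact hc d (mem_multigrading.1 h1 d hd)
    · by_contra hd
      exact hc d (mem_multigrading.1 h2 d hd)
  obtain ⟨e, rfl⟩ := this
  refine ⟨e, (coeff e (D.gen i).1, coeff e ((D.gen i).2 : MvPolynomial (Fin n) K)), fun h0 => ?_,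
    eq_monomial_of_mem_multigrading h1, eq_monomial_of_mem_multigrading h2⟩
  rw [Prod.mk_eq_zero] at h0
  refine hne (Prod.ext ?_ (Subtype.ext ?_))
  · rw [eq_monomial_of_mem_multigrading h1, h0.1, monomial_zero]; rfl
  · have h : ((D.gen i).2 : MvPolynomial (Fin n) K) = _ := eq_monomial_of_mem_multigrading h2
    exact h.trans ((congrArg (monomial e) h0.2).trans (monomial_zero))

/-- The exponent of a generator of a Stanley decomposition of `R ⊕ m`. -/
noncomputable def genExponent (D : StanleyDecomposition (directSumGrading K n)) (i : Fin D.size) :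
    Fin n →₀ ℕ :=
  (D.exists_gen_eq_monomial i).choose

/-- The coefficients of the two components of a generator. -/
noncomputable def genCoeff (D : StanleyDecomposition (directSumGrading K n)) (i : Fin D.size) :
    K × K :=
  (D.exists_gen_eq_monomial i).choose_spec.choose

theorem genCoeff_ne_zero (D : StanleyDecomposition (directSumGrading K n)) (i : Fin D.size) :
    D.genCoeff i ≠ 0 :=
  (D.exists_gen_eq_monomial i).choose_spec.choose_spec.1

theorem gen_fst (D : StanleyDecomposition (directSumGrading K n)) (i : Fin D.size) :
    (D.gen i).1 = monomial (D.genExponent i) (D.genCoeff i).1 :=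
  (D.exists_gen_eq_monomial i).choose_spec.choose_spec.2.1

theorem gen_snd (D : StanleyDecomposition (directSumGrading K n)) (i : Fin D.size) :
    ((D.gen i).2 : MvPolynomial (Fin n) K) = monomial (D.genExponent i) (D.genCoeff i).2 :=
  (D.exists_gen_eq_monomial i).choose_spec.choose_spec.2.2

open Classical in
/-- The indices of the summands with a nonzero component of degree `a`. -/
noncomputable def indicesAt (D : StanleyDecomposition (directSumGrading K n)) (a : Fin n →₀ ℕ) :
    Finset (Fin D.size) :=
  Finset.univ.filter fun i => D.genExponent i ≤ a ∧
    (a - D.genExponent i).support ⊆ (D.retract i).vars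

theorem mem_indicesAt {D : StanleyDecomposition (directSumGrading K n)} {a : Fin n →₀ ℕ}
    {i : Fin D.size} : i ∈ D.indicesAt a ↔
      D.genExponent i ≤ a ∧ (a - D.genExponent i).support ⊆ (D.retract i).vars := by
  simp [indicesAt]

/-- In degree a, the i-th summand contributes the line through `genCoeff i` if i ∈ `indicesAt a`,
and nothing otherwise. Independence and, in `coeff_mem_span_genCoeff`, generation are the directness
and exhaustiveness of the decomposition read in this degree. -/
theorem linearIndependent_genCoeff (D : StanleyDecomposition (directSumGrading K n))
    (a : Fin n →₀ ℕ) : LinearIndependent K fun i : D.indicesAt a => D.genCoeff i := by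
  classical
  rw [Fintype.linearIndependent_iff]
  intro c hc i
  have hc1 := congrArg Prod.fst hc
  have hc2 := congrArg Prod.snd hc
  rw [Prod.fst_sum] at hc1
  rw [Prod.snd_sum] at hc2
  let r : Fin D.size → MvPolynomial (Fin n) K := fun i =>
    if h : i ∈ D.indicesAt a then monomial (a - D.genExponent i) (c ⟨i, h⟩) else 0
  have hr : ∀ i, r i ∈ (D.retract i).subalgebra := by
    intro i
    by_cases h : i ∈ D.indicesAt a
    · simp only [r, dif_pos h]
      exact GradedRetract.monomial_mem_subalgebra (mem_indicesAt.1 h).2 _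
    · simp only [r, dif_neg h]
      exact zero_mem _
  have hsum : ∑ i, r i • D.gen i = 0 := by
    have hattach : ∑ i, r i • D.gen i =
        ∑ i : D.indicesAt a, monomial (a - D.genExponent i) (c i) • D.gen i := by
      rw [← Finset.sum_subset (Finset.subset_univ (D.indicesAt a)), ← Finset.sum_coe_sort]
      · refine Finset.sum_congr rfl fun j _ => ?_
        simp only [r, dif_pos j.2]
      · intro j _ hj
        simp only [r, dif_neg hj, zero_smul]
    rw [hattach]
    refine Prod.ext ?_ (Subtype.ext ?_)
    · rw [Prod.fst_sum, Prod.fst_zero]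
      calc ∑ j : D.indicesAt a, (monomial (a - D.genExponent j) (c j) • D.gen j).1
          = ∑ j : D.indicesAt a, monomial a (c j * (D.genCoeff j).1) := by
            refine Finset.sum_congr rfl fun j _ => ?_
            rw [Prod.smul_fst, smul_eq_mul, gen_fst, monomial_mul,
              tsub_add_cancel_of_le (mem_indicesAt.1 j.2).1]
        _ = 0 := by
            rw [← map_sum, show ∑ j : D.indicesAt a, c j * (D.genCoeff j).1 = 0 from hc1, map_zero]
    · rw [Prod.snd_sum, AddSubmonoidClass.coe_finsetSum]
      calc ∑ j : D.indicesAt a, ((monomial (a - D.genExponent j) (c j) • D.gen j).2 :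
              MvPolynomial (Fin n) K)
          = ∑ j : D.indicesAt a, monomial a (c j * (D.genCoeff j).2) := by
            refine Finset.sum_congr rfl fun j _ => ?_
            rw [Prod.smul_snd, Submodule.coe_smul, smul_eq_mul, gen_snd, monomial_mul,
              tsub_add_cancel_of_le (mem_indicesAt.1 j.2).1]
        _ = 0 := by
            rw [← map_sum, show ∑ j : D.indicesAt a, c j * (D.genCoeff j).2 = 0 from hc2, map_zero]
  have h0 := (isInternal_iff_forall_exists.1 D.isInternal).2 (fun i => r i • D.gen i)
    (fun i => ⟨r i, hr i, rfl⟩) hsum i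
  have hri := D.ann_eq_zero i _ (hr i) h0
  simp only [r, dif_pos i.2] at hri
  exact monomial_eq_zero.1 hri

theorem coeff_mem_span_genCoeff (D : StanleyDecomposition (directSumGrading K n))
    (a : Fin n →₀ ℕ) (v : MvPolynomial (Fin n) K × idealOfVars (Fin n) K) :
    (coeff a v.1, coeff a (v.2 : MvPolynomial (Fin n) K)) ∈
      Submodule.span K (Set.range fun i : D.indicesAt a => D.genCoeff i) := by
  obtain ⟨f, hf, rfl⟩ := (isInternal_iff_forall_exists.1 D.isInternal).1 v
  have hmk : ∀ g h : Fin D.size → K, (∑ i, g i, ∑ i, h i) = ∑ i, (g i, h i) := fun g h => by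
    ext <;> simp [Prod.fst_sum, Prod.snd_sum]
  rw [Prod.fst_sum, Prod.snd_sum, AddSubmonoidClass.coe_finsetSum, coeff_sum, coeff_sum, hmk]
  refine Submodule.sum_mem _ fun i _ => ?_
  obtain ⟨r, hr, hri⟩ := mem_retractSpan.1 (hf i)
  rw [← hri, Prod.smul_fst, Prod.smul_snd, Submodule.coe_smul, smul_eq_mul, smul_eq_mul, gen_fst,
    gen_snd, coeff_mul_monomial', coeff_mul_monomial']
  split_ifs with h
  · by_cases h0 : coeff (a - D.genExponent i) r = 0
    · simp only [h0, zero_mul]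
      exact zero_mem _
    · exact Submodule.smul_mem _ (coeff (a - D.genExponent i) r) (Submodule.subset_span
        ⟨⟨i, mem_indicesAt.2 ⟨h, GradedRetract.mem_subalgebra.1 hr _ h0⟩⟩, rfl⟩)
  · exact zero_mem _

theorem card_indicesAt (D : StanleyDecomposition (directSumGrading K n)) {a : Fin n →₀ ℕ}
    (ha : a ≠ 0) : (D.indicesAt a).card = 2 := by
  classical
  have hspan : ⊤ ≤ Submodule.span K (Set.range fun i : D.indicesAt a => D.genCoeff i) := by
    rintro ⟨x, y⟩ -
    have hy : monomial a y ∈ idealOfVars (Fin n) K := by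
      rw [mem_idealOfVars_iff, coeff_monomial, if_neg ha]
    have := D.coeff_mem_span_genCoeff a (monomial a x, ⟨monomial a y, hy⟩)
    simpa only [coeff_monomial, if_true] using this
  have := Module.finrank_eq_card_basis (Module.Basis.mk (D.linearIndependent_genCoeff a) hspan)
  rw [Module.finrank_prod, Module.finrank_self, Fintype.card_coe] at this
  exact this.symm

theorem mem_indicesAt_zero {D : StanleyDecomposition (directSumGrading K n)} {i : Fin D.size} :
    i ∈ D.indicesAt 0 ↔ D.genExponent i = 0 := by
  rw [mem_indicesAt]
  simp +contextual

/-- Elements of m have no constant term, so in degree 0 only the line K × 0 is available. -/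
theorem card_indicesAt_zero (D : StanleyDecomposition (directSumGrading K n)) :
    (D.indicesAt 0).card = 1 := by
  classical
  refine le_antisymm ?_ (Finset.card_pos.2 ?_)
  · rw [Finset.card_le_one_iff]
    have hsnd : ∀ i ∈ D.indicesAt 0, (D.genCoeff i).2 = 0 := by
      intro i hi
      have h := mem_idealOfVars_iff.1 (D.gen i).2.2
      rwa [gen_snd, mem_indicesAt_zero.1 hi, coeff_monomial, if_pos rfl] at h
    intro i j hi hj
    by_contra hij
    have hli := (D.linearIndependent_genCoeff 0).comp (fun b : Bool => bif b then ⟨i, hi⟩ else ⟨j, hj⟩)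
      (by rintro (_ | _) (_ | _) h <;> simp_all)
    rw [Fintype.linearIndependent_iff] at hli
    have h1 := hli (fun b => bif b then (D.genCoeff j).1 else -(D.genCoeff i).1) (by
      simp only [Fintype.sum_bool, Function.comp, cond_true, cond_false]
      ext
      · simp only [Prod.fst_add, Prod.smul_fst, smul_eq_mul, Prod.fst_zero]; ring
      · simp [hsnd i hi, hsnd j hj]) true
    exact D.genCoeff_ne_zero j (Prod.ext h1 (hsnd j hj))
  · by_contra h
    rw [Finset.not_nonempty_iff_eq_empty] at h
    have h1 := D.coeff_mem_span_genCoeff 0 (1, 0)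
    have : IsEmpty (D.indicesAt 0) := by rw [h]; infer_instance
    rw [Set.range_eq_empty, Submodule.span_empty, Submodule.mem_bot] at h1
    simpa using congrArg Prod.fst h1

/-- Counting the components of total degree two bounds the number of variables of the retracts in
a Stanley decomposition of `R ⊕ m`. -/
theorem exists_card_vars_bound (D : StanleyDecomposition (directSumGrading K n)) {d : ℕ}
    (hd : ∀ i, d ≤ (D.retract i).vars.card) :
    ∃ z, d ≤ z ∧ z ≤ n ∧ z * z + z + 2 * (d * (2 * n - z)) ≤ 2 * (n * n) + 2 * n := by
  classical
  -- o is the one summand generated in degree 0, and Z its set of variables.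
  obtain ⟨o, ho⟩ := Finset.card_eq_one.1 D.card_indicesAt_zero
  have hexp : ∀ i, D.genExponent i = 0 ↔ i = o := fun i => by
    rw [← mem_indicesAt_zero, ho, Finset.mem_singleton]
  have ho0 := (hexp o).2 rfl
  set Z := (D.retract o).vars with hZ
  let T : Fin n → Finset (Fin D.size) := fun j =>
    Finset.univ.filter fun i => D.genExponent i = Finsupp.single j 1
  have hT : ∀ {i j}, i ∈ T j ↔ D.genExponent i = Finsupp.single j 1 := by simp [T]
  have hoT : ∀ j, o ∉ T j := fun j h => by
    rw [hT, ho0] at h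
    exact (Finsupp.single_ne_zero.2 one_ne_zero) h.symm
  have hTT : ∀ {i j k}, i ∈ T j → i ∈ T k → j = k := fun h1 h2 => by
    rw [hT] at h1 h2
    exact Finsupp.single_left_injective one_ne_zero (h1.symm.trans h2)
  -- The two dimensions in degree eⱼ come from generators of that degree and, if j ∈ Z, from o.
  have hTcard : ∀ j, (T j).card + (if j ∈ Z then 1 else 0) = 2 := by
    intro j
    rw [← D.card_indicesAt (Finsupp.single_ne_zero.2 one_ne_zero : Finsupp.single j 1 ≠ 0)]
    have : D.indicesAt (Finsupp.single j 1) = T j ∪ (if j ∈ Z then {o} else ∅) := by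
      ext i
      rw [mem_indicesAt, Finset.mem_union, hT]
      constructor
      · rintro ⟨h1, h2⟩
        by_cases h0 : D.genExponent i = 0
        · obtain rfl := (hexp i).1 h0
          rw [h0, tsub_zero, Finsupp.support_single _ one_ne_zero, Finset.singleton_subset_iff] at h2
          exact Or.inr (by simp [hZ, h2])
        · left
          obtain ⟨k, hk⟩ := Finsupp.support_nonempty_iff.2 h0
          rw [Finsupp.mem_support_iff] at hk
          refine le_antisymm h1 ?_
          have hkj : k = j := by
            by_contra hkj
            have := h1 k
            rw [Finsupp.single_eq_of_ne hkj] at this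
            omega
          rw [Finsupp.single_le_iff, ← hkj]
          omega
      · rintro (h | h)
        · rw [h]
          exact ⟨le_rfl, by simp⟩
        · have hj : j ∈ Z := by by_contra hj; simp [hj] at h
          rw [if_pos hj, Finset.mem_singleton] at h
          rw [h, ho0, tsub_zero, Finsupp.support_single _ one_ne_zero, Finset.singleton_subset_iff]
          exact ⟨bot_le, hj⟩
    rw [this, Finset.card_union_of_disjoint]
    · congr 1
      split_ifs <;> rfl
    · split_ifs
      · exact Finset.disjoint_singleton_right.2 (hoT j)
      · exact Finset.disjoint_empty_right _
  let t : Fin n → Fin n → Finset (Fin D.size) := fun j k =>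
    (T j).filter fun i => k ∈ (D.retract i).vars
  have hmemT : ∀ {i j k}, i ∈ t j k → i ∈ D.indicesAt (Finsupp.single j 1 + Finsupp.single k 1) := by
    intro i j k hi
    obtain ⟨h1, h2⟩ := Finset.mem_filter.1 hi
    rw [hT] at h1
    rw [mem_indicesAt, h1, add_tsub_cancel_left, Finsupp.support_single _ one_ne_zero]
    exact ⟨le_self_add, by simpa using h2⟩
  have hmemo : ∀ {j k}, j ∈ Z → k ∈ Z →
      o ∈ D.indicesAt (Finsupp.single j 1 + Finsupp.single k 1) := by
    intro j k hj hk
    rw [mem_indicesAt, ho0, tsub_zero]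
    refine ⟨bot_le, Finsupp.support_add.trans (Finset.union_subset ?_ ?_)⟩
    · exact Finsupp.support_single_subset.trans (by simpa using hj)
    · exact Finsupp.support_single_subset.trans (by simpa using hk)
  have hne : ∀ j k : Fin n, (Finsupp.single j 1 + Finsupp.single k 1 : Fin n →₀ ℕ) ≠ 0 := by
    intro j k h
    have := DFunLike.congr_fun h j
    simp at this
  have ho_card : ∀ j k, (if j ∈ Z ∧ k ∈ Z then {o} else ∅ : Finset (Fin D.size)).card =
      (if j ∈ Z then 1 else 0) * (if k ∈ Z then 1 else 0) := by
    intro j k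
    by_cases hj : j ∈ Z <;> by_cases hk : k ∈ Z <;> simp [hj, hk]
  have ho_disj : ∀ j k l m, Disjoint (t l m) (if j ∈ Z ∧ k ∈ Z then {o} else ∅) := by
    intro j k l m
    split_ifs
    · exact Finset.disjoint_singleton_right.2 fun h => hoT l (Finset.mem_filter.1 h).1
    · exact Finset.disjoint_empty_right _
  have ho_sub : ∀ j k, (if j ∈ Z ∧ k ∈ Z then {o} else ∅) ⊆
      D.indicesAt (Finsupp.single j 1 + Finsupp.single k 1) := by
    intro j k
    split_ifs with h
    · exact Finset.singleton_subset_iff.2 (hmemo h.1 h.2)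
    · exact Finset.empty_subset _
  -- Only an inequality, since new generators may occur in degree eⱼ + eₖ. On the diagonal the
  -- inequality for 2eⱼ is doubled, so that summing over ordered pairs is uniform.
  have hpair : ∀ j k, (t j k).card + (t k j).card +
      (if j ∈ Z then 1 else 0) * (if k ∈ Z then 1 else 0) +
      (if j = k then (if j ∈ Z then 1 else 0) else 0) ≤ 2 + (if j = k then 2 else 0) := by
    intro j k
    by_cases hjk : j = k
    · subst hjk
      have h := Finset.card_le_card (Finset.union_subset (fun i => hmemT (i := i) (j := j) (k := j))
        (ho_sub j j))
      rw [Finset.card_union_of_disjoint (ho_disj j j j j), D.card_indicesAt (hne j j), ho_card] at h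
      by_cases hj : j ∈ Z <;> simp only [hj, if_true, if_false] at h ⊢ <;> omega
    · have h := Finset.card_le_card (Finset.union_subset (Finset.union_subset
        (fun i => hmemT (i := i) (j := j) (k := k))
        (fun i hi => by rw [add_comm]; exact hmemT (i := i) (j := k) (k := j) hi)) (ho_sub j k))
      rw [Finset.card_union_of_disjoint (Finset.disjoint_union_left.2
          ⟨ho_disj j k j k, ho_disj j k k j⟩), Finset.card_union_of_disjoint,
        D.card_indicesAt (hne j k), ho_card] at h
      · simpa [hjk] using h
      · rw [Finset.disjoint_left]
        exact fun i h1 h2 => hjk (hTT (Finset.mem_filter.1 h1).1 (Finset.mem_filter.1 h2).1)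
  have hsumZ : ∑ j, (if j ∈ Z then 1 else 0) = Z.card := by simp
  have hsumT : ∑ j, (T j).card + Z.card = 2 * n := by
    rw [← hsumZ, ← Finset.sum_add_distrib, Finset.sum_congr rfl fun j _ => hTcard j]
    simp [mul_comm]
  -- Each generator of degree eⱼ has a multiple in degree eⱼ + eₖ for each of its at least d
  -- variables xₖ.
  have hsumt : d * ∑ j, (T j).card ≤ ∑ j, ∑ k, (t j k).card := by
    rw [Finset.mul_sum]
    refine Finset.sum_le_sum fun j _ => ?_
    have : ∑ k, (t j k).card = ∑ i ∈ T j, (D.retract i).vars.card := by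
      simp only [t, Finset.card_filter]
      rw [Finset.sum_comm]
      simp
    rw [this, mul_comm]
    exact Finset.card_nsmul_le_sum _ _ _ fun i _ => hd i
  have htotal := Finset.sum_le_sum fun j (_ : j ∈ Finset.univ) =>
    Finset.sum_le_sum fun k (_ : k ∈ Finset.univ) => hpair j k
  simp only [Finset.sum_add_distrib] at htotal
  rw [Finset.sum_comm (f := fun j k => (t k j).card), ← Finset.sum_mul_sum, hsumZ] at htotal
  simp only [Finset.sum_ite_eq, Finset.mem_univ, if_true, hsumZ] at htotal
  simp only [Finset.sum_const, Finset.card_univ, Fintype.card_fin, smul_eq_mul] at htotal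
  refine ⟨Z.card, hd o, by simpa using Finset.card_le_univ Z, ?_⟩
  rw [show 2 * n - Z.card = ∑ j, (T j).card by omega]
  linarith

theorem exists_card_vars_le {n : ℕ} (hn : n ∈ ({1, 2, 3, 4, 5, 7, 9, 11} : Finset ℕ))
    (D : StanleyDecomposition (directSumGrading K n)) :
    ∃ i, (D.retract i).vars.card ≤ (n + 1) / 2 := by
  by_contra! h
  obtain ⟨z, h1, h2, h3⟩ := D.exists_card_vars_bound (d := (n + 1) / 2 + 1) h
  -- For z ≥ d the left side of `h3` is smallest at z = d, with value 4dn − d(d − 1). With d =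
  -- (n+1)/2 + 1 this exceeds 2n² + 2n when n² − 12n + 3 < 0 for odd n, and when n < 6 for even n:
  -- precisely the listed values.
  fin_cases hn <;> interval_cases z <;> omega

end StanleyDecomposition

/-! ### The common value of the two Stanley depths -/

theorem depth_directSum_le (hn : n ∈ ({1, 2, 3, 4, 5, 7, 9, 11} : Finset ℕ))
    (D : StanleyDecomposition (directSumGrading K n)) : D.depth ≤ ((n + 1) / 2 : ℕ) := by
  obtain ⟨i, hi⟩ := D.exists_card_vars_le hn
  exact (moduleDepth_le_card_vars D.retract i).trans (by exact_mod_cast hi)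

theorem StanleyDecomposition.size_pos [Nonempty (Fin n)]
    (D : StanleyDecomposition (maxIdealGrading K n)) : 0 < D.size := by
  rw [Nat.pos_iff_ne_zero]
  intro h
  have : IsEmpty (Fin D.size) := by rw [h]; infer_instance
  obtain ⟨j⟩ := ‹Nonempty (Fin n)›
  obtain ⟨f, -, hf⟩ := (isInternal_iff_forall_exists.1 D.isInternal).1
    (⟨X j, Ideal.subset_span ⟨j, rfl⟩⟩ : idealOfVars (Fin n) K)
  rw [Finset.univ_eq_empty, Finset.sum_empty] at hf
  exact X_ne_zero j (Subtype.ext_iff.1 hf).symm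

theorem depth_maxIdeal_le (hn : n ∈ ({1, 2, 3, 4, 5, 7, 9, 11} : Finset ℕ))
    (D : StanleyDecomposition (maxIdealGrading K n)) : D.depth ≤ ((n + 1) / 2 : ℕ) := by
  have hn0 : 0 < n := by
    rw [Nat.pos_iff_ne_zero]
    rintro rfl
    simp at hn
  have : Nonempty (Fin n) := ⟨⟨0, hn0⟩⟩
  suffices h : ∃ i, (D.retract i).vars.card ≤ (n + 1) / 2 by
    obtain ⟨i, hi⟩ := h
    exact (moduleDepth_le_card_vars D.retract i).trans (by exact_mod_cast hi)
  obtain ⟨i, hi⟩ := D.consFree.exists_card_vars_le hn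
  induction i using Fin.cases with
  -- If the small retract is the added summand R, then n ≤ (n+1)/2 and any summand of m will do.
  | zero =>
    have h1 : n ≤ (n + 1) / 2 := by
      have : (D.consFree.retract (0 : Fin (D.size + 1))).vars = Finset.univ :=
      GradedRetract.vars_ofVars _
      rwa [this, Finset.card_univ, Fintype.card_fin] at hi
    exact ⟨⟨0, D.size_pos⟩, (Finset.card_le_univ _).trans (by simpa using h1)⟩
  | succ i => exact ⟨i, hi⟩

/-- One interval decomposition serves both modules: the extra summand R has n ≥ (n+1)/2 variables.
-/
theorem exists_depth_ge (K : Type u) [Field K] (hn : n ∈ ({1, 2, 3, 4, 5, 7, 9, 11} : Finset ℕ)) :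
    ∃ D : StanleyDecomposition (maxIdealGrading K n),
      ((n + 1) / 2 : ℕ) ≤ D.depth ∧ ((n + 1) / 2 : ℕ) ≤ D.consFree.depth := by
  have hn0 : 0 < n := by
    rw [Nat.pos_iff_ne_zero]
    rintro rfl
    simp at hn
  have : Nonempty (Fin n) := ⟨⟨0, hn0⟩⟩
  obtain ⟨N, A, B, hA, hAB, hB, h⟩ := exists_interval_partition hn
  let D := intervalDecomposition K A B hA hAB h
  have hD : ∀ i, (n + 1) / 2 ≤ (D.retract i).vars.card := fun i =>
    (hB i).trans_eq (congrArg Finset.card (GradedRetract.vars_ofVars (K := K) (B i)).symm)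
  refine ⟨D, le_moduleDepth_of_le_card_vars D.size_pos D.retract hD,
    le_moduleDepth_of_le_card_vars (Nat.succ_pos D.size) D.consFree.retract
      (Fin.cases ?_ fun i => hD i)⟩
  have : (D.consFree.retract (0 : Fin (D.size + 1))).vars = Finset.univ :=
      GradedRetract.vars_ofVars _
  rw [this, Finset.card_univ, Fintype.card_fin]
  omega

theorem isGreatest_sdepth {M : Type*} [AddCommGroup M]
    [Module (MvPolynomial (Fin n) K) M] [Module K M] [IsScalarTower K (MvPolynomial (Fin n) K) M]
    [Nontrivial M] {𝓜 : (Fin n → ℤ) → Submodule K M} {c : ℕ∞}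
    (hle : ∀ D : StanleyDecomposition 𝓜, D.depth ≤ c)
    (hge : ∃ D : StanleyDecomposition 𝓜, c ≤ D.depth) :
    IsGreatest (stanleyDepths 𝓜) (sdepth 𝓜) ∧ sdepth 𝓜 = c := by
  obtain ⟨D, hD⟩ := hge
  have hg : IsGreatest (stanleyDepths 𝓜) c :=
    ⟨⟨D, le_antisymm (hle D) hD⟩, by rintro _ ⟨D, rfl⟩; exact hle D⟩
  have hs : sdepth 𝓜 = c := by
    rw [sdepth, if_neg (not_subsingleton M)]
    exact hg.csSup_eq
  exact ⟨hs ▸ hg, hs⟩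

end StanleyDepth

theorem proposition2p6 (K : Type*) [Field K] (n : ℕ)
    (hn : n ∈ ({1, 2, 3, 4, 5, 7, 9, 11} : Finset ℕ)) :
    IsGreatest (StanleyDepth.stanleyDepths (StanleyDepth.maxIdealGrading K n))
      (StanleyDepth.sdepth (StanleyDepth.maxIdealGrading K n)) ∧
    IsGreatest (StanleyDepth.stanleyDepths (StanleyDepth.directSumGrading K n))
      (StanleyDepth.sdepth (StanleyDepth.directSumGrading K n)) ∧
    StanleyDepth.sdepth (StanleyDepth.maxIdealGrading K n) =
      StanleyDepth.sdepth (StanleyDepth.directSumGrading K n) := by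
  obtain ⟨D, hD1, hD2⟩ := StanleyDepth.exists_depth_ge K hn
  have hn0 : 0 < n := by
    rw [Nat.pos_iff_ne_zero]
    rintro rfl
    simp at hn
  have : Nontrivial (idealOfVars (Fin n) K) :=
    ⟨⟨⟨X ⟨0, hn0⟩, Ideal.subset_span ⟨_, rfl⟩⟩, 0, fun h => X_ne_zero _ (Subtype.ext_iff.1 h)⟩⟩
  obtain ⟨h1, h2⟩ := StanleyDepth.isGreatest_sdepth
    (StanleyDepth.depth_maxIdeal_le (K := K) hn) ⟨D, hD1⟩
  obtain ⟨h3, h4⟩ := StanleyDepth.isGreatest_sdepth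
    (StanleyDepth.depth_directSum_le (K := K) hn)
    ⟨D.consFree, hD2⟩
  exact ⟨h1, h3, h2.trans h4.symm⟩
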